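/- Let $K$ be a field and let $E=(E^0,E^1,r,s)$ be a finite directed graph with disjoint cycles, i.e. every vertex is the base of at most one cycle $e_1\cdots e_n$ with $n\ge 1$ ($r(e_i)=s(e_{i+1})$, $r(e_n)=s(e_1)$, and the $s(e_i)$ pairwise distinct). Let $\overline u\in E^0$ be a source vertex ($r^{-1}(\overline u)=\emptyset$) which is not isolated, i.e. $s^{-1}(\overline u)\neq\emptyset$. Put $H=E^0\setminus\{\overline u\}$, which is a hereditary set of vertices; let $E_H$ be the graph with vertex set $H$ and edge set $\{e\in E^1: s(e)\in H\}$, and let $\varepsilon=\sum_{u\in H}u\in L_K(E)$, where $L_K(E)$ is the Leavitt path algebra. Then sending $v\mapsto v$, $e\mapsto e$, $e^*\mapsto e^*$ ($v\in H$, $s(e)\in H$) defines an isomorphism of $K$-algebras $L_K(E_H)\cong\varepsilon L_K(E)\varepsilon$. Identifying these two algebras along it, the functors $$\varepsilon L_K(E)\otimes_{L_K(E)}-\;:\;L_K(E)\text{-Mod}\to L_K(E_H)\text{-Mod},\qquad L_K(E)\varepsilon\otimes_{\varepsilon L_K(E)\varepsilon}-\;:\;L_K(E_H)\text{-Mod}\to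 L_K(E)\text{-Mod}$$ are the two functors of a ($K$-linear) Morita equivalence between $L_K(E)$ and $L_K(E_H)$. Moreover, let $c$ be any cycle of $E$, where from now on "cycle" means either a proper cycle $c=e_1\cdots e_n$ ($n\ge1$) as above, or a sink $c=w$, regarded as a cycle of length $0$ with $s(c)=w$. Then $c$ is a cycle of $E_H$, and there is an isomorphism of left $L_K(E)$-modules $$\widehat U_{E,c-1}\;\cong\; L_K(E)\varepsilon\otimes_{\varepsilon L_K(E)\varepsilon}\widehat U_{E_H,c-1}.$$ Here, for a finite graph $E$ and a cycle $c$ of $E$, $\widehat U_{E,c-1}$ is the following left $L_K(E)$-module. Let $\mathcal P_c$ be the set of finite paths $\gamma$ in $E$ with $r(\gamma)=s(c)$ which, if $c$ is proper, are not of the form $\gamma'c$. Let $\mathbb I_c=\{1,2,3,\dots\}$ if $c$ is proper and $\mathbb I_c=\{1\}$ if $c$ is a sink. As a $K$-vector space, $$\widehat U_{E,c-1}=\bigoplus_{j\in\mathbb I_c}K[[\mathcal P_c]]\,\alpha_{c,j},$$ where $K[[\mathcal P_c]]$ is the space of all formal series $\sum_{\mu\in\mathcal P_c}\mathfrak p(\mu)\mu$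 with coefficients in $K$. Put $\alpha_{c,0}=0$. The generators of $L_K(E)$ act, coefficientwise on formal series, as follows (for $\mu\in\mathcal P_c$, $j\in\mathbb I_c$): - a vertex $v$ sends $\mu\alpha_{c,j}$ to itself if $s(\mu)=v$ and to $0$ otherwise; - an edge $e$ sends $\mu\alpha_{c,j}$ to $0$ if $r(e)\ne s(\mu)$, to $(e\mu)\alpha_{c,j}$ if $r(e)=s(\mu)$ and $e\mu\in\mathcal P_c$, and to $s(c)(\alpha_{c,j}+\alpha_{c,j-1})$ if $e\mu=c$ (these are all cases); - a ghost edge $e^*$ sends $\mu\alpha_{c,j}$ to $\mu'\alpha_{c,j}$ if $\mu=e\mu'$, to $\nu\sum_{l=0}^{j-1}(-1)^l\alpha_{c,j-l}$ if $\mu=s(c)$ and $c=e\nu$, and to $0$ in all other cases. -/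

import Mathlib

universe u w k a b x t

noncomputable section

section Graphs

/-- A directed graph `E = (E⁰, E¹, r, s)` with vertex set `V` and edge set `X`
(loops and parallel edges are allowed). -/
structure DirGraph (V : Type u) (X : Type w) where
  /-- the source map -/
  s : X → V
  /-- the range map -/
  r : X → V

namespace DirGraph

variable {V : Type u} {X : Type w} (E : DirGraph V X)

/-- A sink emits no edges. -/
def IsSink (v : V) : Prop := ∀ e, E.s e ≠ v

/-- A source vertex receives no edges. -/
def IsSource (v : V) : Prop := ∀ e, E.r e ≠ v

/-- `E.IsWalk v l`: the list `l = [e₁, …, eₙ]` of edges satisfies `s(e₁) = v` (if `n ≥ 1`) and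
`r(eᵢ) = s(eᵢ₊₁)`. -/
def IsWalk (E : DirGraph V X) : V → List X → Prop
  | _, [] => True
  | v, e :: l => E.s e = v ∧ E.IsWalk (E.r e) l

/-- The vertex at which a walk starting at the given vertex ends. -/
def endpoint (E : DirGraph V X) : V → List X → V
  | v, [] => v
  | _, e :: l => E.endpoint (E.r e) l

/-- `Path(E)`: finite paths, including the trivial path at each vertex. -/
@[ext]
structure FinPath where
  /-- the source of the path -/
  source : V
  /-- the sequence of edges of the path -/
  edges : List X
  isWalk : E.IsWalk source edges

variable {E}

/-- The range of a path. -/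
def FinPath.range (γ : E.FinPath) : V := E.endpoint γ.source γ.edges

variable (E) in
/-- The trivial path (of length `0`) at a vertex. -/
def trivialPath (v : V) : E.FinPath := ⟨v, [], trivial⟩

/-- `IsCons e μ' μ` says that `μ` is the concatenation `e μ'` of the edge `e` and the path `μ'`. -/
structure IsCons (e : X) (μ' μ : E.FinPath) : Prop where
  source_eq : μ.source = E.s e
  range_eq : E.r e = μ'.source
  edges_eq : μ.edges = e :: μ'.edges

variable (E) in
/-- A cycle in the wide sense: either a proper cycle, i.e. a closed path `e₁ ⋯ eₙ` with `n ≥ 1` and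
`s(eᵢ) ≠ s(eⱼ)` for `i ≠ j`, or the trivial path at a sink. -/
structure Cycle extends FinPath E where
  closed : E.endpoint source edges = source
  simple : (edges.map E.s).Nodup
  sink_of_nil : edges = [] → E.IsSink source

/-- A proper cycle is a cycle of length at least one. -/
def Cycle.IsProper (c : E.Cycle) : Prop := c.edges ≠ []

variable (E) in
/-- Every vertex is the base of at most one (proper) cycle. -/
def HasDisjointCycles : Prop :=
  ∀ c d : E.Cycle, c.IsProper → d.IsProper → c.source = d.source → c = d

variable (E) in
/-- A set of vertices is hereditary if it is closed under following paths. -/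
def IsHereditary (H : Set V) : Prop :=
  ∀ γ : E.FinPath, γ.source ∈ H → γ.range ∈ H

theorem IsHereditary.r_mem {H : Set V} (hH : E.IsHereditary H) {e : X} (he : E.s e ∈ H) :
    E.r e ∈ H :=
  hH ⟨E.s e, [e], rfl, trivial⟩ he

/-- The complement of a source vertex is hereditary. -/
theorem IsSource.isHereditary_compl {v : V} (hv : E.IsSource v) : E.IsHereditary ({v}ᶜ : Set V) := by
  rintro ⟨x, l, hl⟩ hx
  change E.endpoint x l ∈ _
  change x ∈ _ at hx
  induction l generalizing x with
  | nil => exact hx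
  | cons e l ih => exact ih (E.r e) hl.2 (hv e)

variable (E) in
/-- The restriction `E_H` of `E` to a hereditary set `H` of vertices: its vertices are the elements
of `H` and its edges are the edges `e` of `E` with `s(e) ∈ H`. -/
def restrict (H : Set V) (hH : E.IsHereditary H) : DirGraph H {e : X // E.s e ∈ H} where
  s e := ⟨E.s e.1, e.2⟩
  r e := ⟨E.r e.1, hH.r_mem e.2⟩

end DirGraph

end Graphs

section LeavittPathAlgebra

/-- The generating symbols `v`, `e`, `e*` of the Leavitt path algebra. -/
inductive LeavittGen (V : Type u) (X : Type w) : Type (max u w)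
  | vertex (v : V)
  | edge (e : X)
  | ghost (e : X)

namespace DirGraph

variable (K : Type k) [Field K] {V : Type u} {X : Type w} (E : DirGraph V X)

/-- The generator attached to a symbol, in the free unital associative algebra. -/
def freeGen (g : LeavittGen V X) : FreeAlgebra K (LeavittGen V X) := FreeAlgebra.ι K g

/-- The defining relations of the Leavitt path algebra of a finite graph, the relation `∑ v = 1`
expressing that the sum of all vertices is the identity. -/
inductive LeavittRel : FreeAlgebra K (LeavittGen V X) → FreeAlgebra K (LeavittGen V X) → Prop
  | sum_vertex : LeavittRel (∑ᶠ v : V, freeGen K (.vertex v)) 1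
  | vertex_idem (v : V) :
      LeavittRel (freeGen K (.vertex v) * freeGen K (.vertex v)) (freeGen K (.vertex v))
  | vertex_orth (v v' : V) (h : v ≠ v') :
      LeavittRel (freeGen K (.vertex v) * freeGen K (.vertex v')) 0
  | source_edge (e : X) :
      LeavittRel (freeGen K (.vertex (E.s e)) * freeGen K (.edge e)) (freeGen K (.edge e))
  | edge_range (e : X) :
      LeavittRel (freeGen K (.edge e) * freeGen K (.vertex (E.r e))) (freeGen K (.edge e))
  | range_ghost (e : X) :
      LeavittRel (freeGen K (.vertex (E.r e)) * freeGen K (.ghost e)) (freeGen K (.ghost e))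
  | ghost_source (e : X) :
      LeavittRel (freeGen K (.ghost e) * freeGen K (.vertex (E.s e))) (freeGen K (.ghost e))
  | ghost_edge_self (e : X) :
      LeavittRel (freeGen K (.ghost e) * freeGen K (.edge e)) (freeGen K (.vertex (E.r e)))
  | ghost_edge_ne (e f : X) (h : e ≠ f) :
      LeavittRel (freeGen K (.ghost e) * freeGen K (.edge f)) 0
  | sum_edge_ghost (v : V) (h : ¬ E.IsSink v) :
      LeavittRel (freeGen K (.vertex v))
        (∑ᶠ e : {e : X // E.s e = v}, freeGen K (.edge e.1) * freeGen K (.ghost e.1))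

/-- The Leavitt path algebra `L_K(E)` of a finite graph `E`. -/
def LPA : Type (max k u w) := RingQuot (E.LeavittRel K)

instance : Ring (E.LPA K) := inferInstanceAs (Ring (RingQuot (E.LeavittRel K)))

instance : Algebra K (E.LPA K) := inferInstanceAs (Algebra K (RingQuot (E.LeavittRel K)))

/-- The class of a generating symbol in `L_K(E)`. -/
def gen (g : LeavittGen V X) : E.LPA K := RingQuot.mkAlgHom K (E.LeavittRel K) (freeGen K g)

/-- The vertex `v` as an element of `L_K(E)`. -/
def vertex (v : V) : E.LPA K := E.gen K (.vertex v)

/-- The edge `e` as an element of `L_K(E)`. -/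
def edge (e : X) : E.LPA K := E.gen K (.edge e)

/-- The ghost edge `e*` as an element of `L_K(E)`. -/
def ghost (e : X) : E.LPA K := E.gen K (.ghost e)

/-- The sum `∑_{v ∈ H} v` in `L_K(E)`. -/
def vertexSum (H : Set V) : E.LPA K := ∑ᶠ v : H, E.vertex K v.1

theorem vertex_mul_self (v : V) : E.vertex K v * E.vertex K v = E.vertex K v := by
  have h := RingQuot.mkAlgHom_rel K (LeavittRel.vertex_idem (K := K) (E := E) v)
  rw [map_mul] at h
  exact h

theorem vertex_mul_of_ne {v v' : V} (hv : v ≠ v') : E.vertex K v * E.vertex K v' = 0 := by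
  have h := RingQuot.mkAlgHom_rel K (LeavittRel.vertex_orth (K := K) (E := E) v v' hv)
  rw [map_mul, map_zero] at h
  exact h

theorem isIdempotentElem_vertexSum [Finite V] (H : Set V) :
    IsIdempotentElem (E.vertexSum K H) := by
  classical
  have := Fintype.ofFinite H
  unfold IsIdempotentElem vertexSum
  rw [finsum_eq_sum_of_fintype, Finset.sum_mul_sum]
  refine Finset.sum_congr rfl fun v _ => ?_
  rw [Finset.sum_eq_single v]
  · exact E.vertex_mul_self K _
  · intro v' _ hne
    exact E.vertex_mul_of_ne K fun h => hne (Subtype.ext h.symm)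
  · simp

variable {K E}

/-- The universal property of `L_K(E)`: a Cuntz–Krieger `E`-family in `A` (whose vertex idempotents
sum to `1`) induces a `K`-algebra homomorphism `L_K(E) → A`. -/
def liftLPA {A : Type*} [Ring A] [Algebra K A] (P : V → A) (S T : X → A)
    (h₁ : ∑ᶠ v, P v = 1) (h₂ : ∀ v, P v * P v = P v) (h₃ : ∀ v v', v ≠ v' → P v * P v' = 0)
    (h₄ : ∀ e, P (E.s e) * S e = S e) (h₅ : ∀ e, S e * P (E.r e) = S e)
    (h₆ : ∀ e, P (E.r e) * T e = T e) (h₇ : ∀ e, T e * P (E.s e) = T e)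
    (h₈ : ∀ e, T e * S e = P (E.r e)) (h₉ : ∀ e f, e ≠ f → T e * S f = 0)
    (h₁₀ : ∀ v, ¬ E.IsSink v → P v = ∑ᶠ e : {e : X // E.s e = v}, S e.1 * T e.1)
    [Finite V] [Finite X] : E.LPA K →ₐ[K] A :=
  RingQuot.liftAlgHom K ⟨FreeAlgebra.lift K fun g => match g with
    | .vertex v => P v
    | .edge e => S e
    | .ghost e => T e, by
      intro y z hyz
      have := Fintype.ofFinite V
      cases hyz with
      | sum_vertex =>
        rw [finsum_eq_sum_of_fintype] at h₁ ⊢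
        simpa [freeGen] using h₁
      | vertex_idem v => simpa [freeGen] using h₂ v
      | vertex_orth v v' h => simpa [freeGen] using h₃ v v' h
      | source_edge e => simpa [freeGen] using h₄ e
      | edge_range e => simpa [freeGen] using h₅ e
      | range_ghost e => simpa [freeGen] using h₆ e
      | ghost_source e => simpa [freeGen] using h₇ e
      | ghost_edge_self e => simpa [freeGen] using h₈ e
      | ghost_edge_ne e f h => simpa [freeGen] using h₉ e f h
      | sum_edge_ghost v h =>
        have := Fintype.ofFinite {e : X // E.s e = v}
        have h' := h₁₀ v h
        rw [finsum_eq_sum_of_fintype] at h' ⊢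
        simpa [freeGen] using h'⟩

end DirGraph

end LeavittPathAlgebra

section FormalPrufer

namespace DirGraph

variable {V : Type u} {X : Type w} {E : DirGraph V X}

namespace Cycle

variable (c : E.Cycle)

/-- The set `𝒫_c` of paths `γ` with `r(γ) = s(c)` which, if `c` is a proper cycle, are not of the form
`γ' c` (for a path `γ` ending at `s(c)` this means that the edges of `c` are not a final segment of
the edges of `γ`). -/
def paths : Set E.FinPath :=
  {γ | γ.range = c.source ∧ (c.IsProper → ¬ c.edges <:+ γ.edges)}

/-- The index set `𝕀_c`: all `j ≥ 1` if `c` is a proper cycle, only `j = 1` if `c` is a sink. -/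
def indexSet : Set ℕ := {j | 1 ≤ j ∧ (¬ c.IsProper → j = 1)}

/-- The trivial path `s(c)`, an element of `𝒫_c`. -/
def basePath : c.paths :=
  ⟨E.trivialPath c.source, by simp [FinPath.range, trivialPath, endpoint], fun hc h => hc (List.suffix_nil.mp h)⟩

end Cycle

variable (K : Type k) [Field K] (c : E.Cycle)

/-- The underlying vector space of `Û_{E,c-1}`, namely `⨁_{j ∈ 𝕀_c} K[[𝒫_c]] α_{c,j}`, where
`K[[𝒫_c]]` is the space of all maps `𝒫_c → K`. -/
def FormalPrufer : Type (max k u w) := c.indexSet →₀ (c.paths → K)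

instance : AddCommGroup (FormalPrufer K c) :=
  inferInstanceAs (AddCommGroup (c.indexSet →₀ (c.paths → K)))

instance instModuleFieldFormalPrufer : Module K (FormalPrufer K c) :=
  inferInstanceAs (Module K (c.indexSet →₀ (c.paths → K)))

namespace FormalPrufer

variable {K c}

/-- The linear map on `Û` determined by linear maps on its summands `K[[𝒫_c]] α_{c,j}`. -/
def liftLin (F : ℕ → (c.paths → K) →ₗ[K] FormalPrufer K c) :
    Module.End K (FormalPrufer K c) :=
  Finsupp.lsum K fun j : c.indexSet => F j.1

variable (K c)

/-- The inclusion of the summand of `Û` with index `j ∈ 𝕀_c`. -/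
def incl (j : c.indexSet) : (c.paths → K) →ₗ[K] FormalPrufer K c :=
  (Finsupp.lsingle j : (c.paths → K) →ₗ[K] (c.indexSet →₀ (c.paths → K)))

open scoped Classical in
/-- The map `𝔭 ↦ 𝔭 α_{c,j}`, with `α_{c,0} = 0`. -/
def alpha (j : ℕ) : (c.paths → K) →ₗ[K] FormalPrufer K c :=
  if h : j ∈ c.indexSet then incl K c ⟨j, h⟩ else 0

open scoped Classical in
/-- `v · 𝔭`: the part of the formal series `𝔭` supported on the paths starting at `v`. -/
def vertexPart (v : V) : Module.End K (c.paths → K) where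
  toFun p μ := if μ.1.source = v then p μ else 0
  map_add' p q := by ext μ; by_cases h : μ.1.source = v <;> simp [h]
  map_smul' r p := by ext μ; by_cases h : μ.1.source = v <;> simp [h]

open scoped Classical in
/-- `∑ 𝔭(μ') μ' ↦ ∑ 𝔭(μ') e μ'`, the second sum being over the `μ'` such that `e μ'` is defined and
belongs to `𝒫_c`: the coefficient at `μ` is `𝔭(μ')` if `μ = e μ'` and zero if `μ` does not start with
`e`. -/
def edgePart (e : X) : Module.End K (c.paths → K) where
  toFun p μ := if h : ∃ μ' : c.paths, IsCons e μ'.1 μ.1 then p h.choose else 0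
  map_add' p q := by
    ext μ; by_cases h : ∃ μ' : c.paths, IsCons e μ'.1 μ.1 <;> simp only [Pi.add_apply, h] <;> simp
  map_smul' r p := by
    ext μ; by_cases h : ∃ μ' : c.paths, IsCons e μ'.1 μ.1 <;> simp only [Pi.smul_apply, h] <;> simp

open scoped Classical in
/-- `∑ 𝔭(μ) μ ↦ ∑ 𝔭(e μ') μ'`, the second sum being over the `μ'` such that `e μ'` is defined and
belongs to `𝒫_c`. -/
def ghostPart (e : X) : Module.End K (c.paths → K) where
  toFun p μ' := if h : ∃ μ : c.paths, IsCons e μ'.1 μ.1 then p h.choose else 0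
  map_add' p q := by
    ext μ'; by_cases h : ∃ μ : c.paths, IsCons e μ'.1 μ.1 <;> simp only [Pi.add_apply, h] <;> simp
  map_smul' r p := by
    ext μ'; by_cases h : ∃ μ : c.paths, IsCons e μ'.1 μ.1 <;> simp only [Pi.smul_apply, h] <;> simp

open scoped Classical in
/-- If `c = e ν` then `𝔭 ↦ 𝔭(ν) s(c)`; otherwise zero. (The path `ν = e₂ ⋯ eₙ` is the only
`ν ∈ 𝒫_c` for which `e ν` is defined and does not belong to `𝒫_c`.) -/
def wrapPart (e : X) : Module.End K (c.paths → K) :=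
  if h : ∃ ν : c.paths, IsCons e ν.1 c.toFinPath then
    LinearMap.single K (fun _ : c.paths => K) c.basePath ∘ₗ LinearMap.proj h.choose
  else 0

open scoped Classical in
/-- If `c = e ν` then `𝔭 ↦ 𝔭(s(c)) ν`; otherwise zero. -/
def unwrapPart (e : X) : Module.End K (c.paths → K) :=
  if h : ∃ ν : c.paths, IsCons e ν.1 c.toFinPath then
    LinearMap.single K (fun _ : c.paths => K) h.choose ∘ₗ LinearMap.proj c.basePath
  else 0

/-- The action of a vertex on `Û`. -/
def vertexAct (v : V) : Module.End K (FormalPrufer K c) :=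
  liftLin fun j => alpha K c j ∘ₗ vertexPart K c v

/-- The action of an edge on `Û`: one has `e · μ α_j = (e μ) α_j` if the path `e μ` belongs to `𝒫_c`,
`e · ν α_j = c α_j = α_j + α_{j-1}` if `c = e ν`, and `e · μ α_j = 0` if `r(e) ≠ s(μ)`; this is
extended to formal series coefficientwise. -/
def edgeAct (e : X) : Module.End K (FormalPrufer K c) :=
  liftLin fun j => alpha K c j ∘ₗ edgePart K c e
    + (alpha K c j + alpha K c (j - 1)) ∘ₗ wrapPart K c e

/-- The action of a ghost edge on `Û`: one has `e* · (e μ') α_j = μ' α_j`,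
`e* · α_j = ν (α_j - α_{j-1} + α_{j-2} - ⋯)` if `c = e ν`, and `e* · μ α_j = 0` otherwise; this is
extended to formal series coefficientwise. -/
def ghostAct (e : X) : Module.End K (FormalPrufer K c) :=
  liftLin fun j => alpha K c j ∘ₗ ghostPart K c e
    + (∑ l ∈ Finset.range j, (-1 : K) ^ l • alpha K c (j - l)) ∘ₗ unwrapPart K c e

theorem isCons_left_unique {e f : X} {μ₁ μ₂ μ : E.FinPath} (h₁ : IsCons e μ₁ μ)
    (h₂ : IsCons f μ₂ μ) : e = f ∧ μ₁ = μ₂ := by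
  have h := h₁.edges_eq.symm.trans h₂.edges_eq
  simp only [List.cons.injEq] at h
  obtain ⟨rfl, h⟩ := h
  exact ⟨rfl, FinPath.ext (h₁.range_eq.symm.trans h₂.range_eq) h⟩

theorem isCons_right_unique {e : X} {μ μ₁ μ₂ : E.FinPath} (h₁ : IsCons e μ μ₁)
    (h₂ : IsCons e μ μ₂) : μ₁ = μ₂ :=
  FinPath.ext (h₁.source_eq.trans h₂.source_eq.symm) (h₁.edges_eq.trans h₂.edges_eq.symm)

variable {K c}

theorem edgePart_of {e : X} {μ' μ : c.paths} (h : IsCons e μ'.1 μ.1) (p : c.paths → K) :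
    edgePart K c e p μ = p μ' := by
  have hex : ∃ μ' : c.paths, IsCons e μ'.1 μ.1 := ⟨μ', h⟩
  have : hex.choose = μ' := Subtype.ext (isCons_left_unique hex.choose_spec h).2
  simp only [edgePart, LinearMap.coe_mk, AddHom.coe_mk, dif_pos hex, this]

theorem edgePart_not {e : X} {μ : c.paths} (h : ¬ ∃ μ' : c.paths, IsCons e μ'.1 μ.1)
    (p : c.paths → K) : edgePart K c e p μ = 0 := by
  simp only [edgePart, LinearMap.coe_mk, AddHom.coe_mk, dif_neg h]

theorem ghostPart_of {e : X} {μ' μ : c.paths} (h : IsCons e μ'.1 μ.1) (p : c.paths → K) :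
    ghostPart K c e p μ' = p μ := by
  have hex : ∃ μ : c.paths, IsCons e μ'.1 μ.1 := ⟨μ, h⟩
  have : hex.choose = μ := Subtype.ext (isCons_right_unique hex.choose_spec h)
  simp only [ghostPart, LinearMap.coe_mk, AddHom.coe_mk, dif_pos hex, this]

theorem ghostPart_not {e : X} {μ' : c.paths} (h : ¬ ∃ μ : c.paths, IsCons e μ'.1 μ.1)
    (p : c.paths → K) : ghostPart K c e p μ' = 0 := by
  simp only [ghostPart, LinearMap.coe_mk, AddHom.coe_mk, dif_neg h]

open scoped Classical in
theorem wrapPart_of {e : X} {ν : c.paths} (h : IsCons e ν.1 c.toFinPath) (p : c.paths → K) :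
    wrapPart K c e p = Pi.single c.basePath (p ν) := by
  have hex : ∃ ν : c.paths, IsCons e ν.1 c.toFinPath := ⟨ν, h⟩
  have : hex.choose = ν := Subtype.ext (isCons_left_unique hex.choose_spec h).2
  simp only [wrapPart, dif_pos hex, this]
  ext μ
  simp [Pi.single_apply]

theorem wrapPart_not {e : X} (h : ¬ ∃ ν : c.paths, IsCons e ν.1 c.toFinPath) :
    wrapPart K c e = 0 := by
  simp only [wrapPart, dif_neg h]

open scoped Classical in
theorem unwrapPart_of {e : X} {ν : c.paths} (h : IsCons e ν.1 c.toFinPath) (p : c.paths → K) :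
    unwrapPart K c e p = Pi.single ν (p c.basePath) := by
  have hex : ∃ ν : c.paths, IsCons e ν.1 c.toFinPath := ⟨ν, h⟩
  have : hex.choose = ν := Subtype.ext (isCons_left_unique hex.choose_spec h).2
  simp only [unwrapPart, dif_pos hex, this]
  ext μ
  simp [Pi.single_apply]

theorem unwrapPart_not {e : X} (h : ¬ ∃ ν : c.paths, IsCons e ν.1 c.toFinPath) :
    unwrapPart K c e = 0 := by
  simp only [unwrapPart, dif_neg h]

theorem vertexPart_apply_eq {v : V} {μ : c.paths} (h : μ.1.source = v) (p : c.paths → K) :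
    vertexPart K c v p μ = p μ := if_pos h

theorem vertexPart_apply_ne {v : V} {μ : c.paths} (h : μ.1.source ≠ v) (p : c.paths → K) :
    vertexPart K c v p μ = 0 := if_neg h

theorem not_isCons_basePath {e : X} {μ' : E.FinPath} : ¬ IsCons e μ' c.basePath.1 := by
  intro h
  have := h.edges_eq
  simp [Cycle.basePath, trivialPath] at this

theorem ne_cycle (hc : c.IsProper) (μ : c.paths) : μ.1 ≠ c.toFinPath := by
  intro h
  apply μ.2.2 hc
  rw [h]

theorem isProper_of_isCons {e : X} {ν : E.FinPath} (h : IsCons e ν c.toFinPath) : c.IsProper := by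
  intro h'
  have := h.edges_eq
  rw [h'] at this
  simp at this

/-- The tail of a nontrivial path which ends at `s(c)` and is in `𝒫_c` or equal to `c`. -/
theorem exists_tail (μ : E.FinPath) (hr : μ.range = c.source)
    (hμ : c.IsProper → c.edges <:+ μ.edges → c.edges = μ.edges) (hne : μ.edges ≠ []) :
    ∃ e, ∃ μ' : c.paths, IsCons e μ'.1 μ := by
  obtain ⟨v, l, hl⟩ := μ
  cases l with
  | nil => exact absurd rfl hne
  | cons e l =>
    refine ⟨e, ⟨⟨E.r e, l, hl.2⟩, hr, fun hc hs => ?_⟩, hl.1.symm, rfl, rfl⟩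
    have h1 := hμ hc (hs.trans (List.suffix_cons e l))
    have h2 := hs.length_le
    change c.edges.length ≤ l.length at h2
    rw [h1] at h2
    simp at h2

theorem edge_range_part (e : X) (p : c.paths → K) :
    edgePart K c e (vertexPart K c (E.r e) p) = edgePart K c e p := by
  ext μ
  by_cases h : ∃ μ' : c.paths, IsCons e μ'.1 μ.1
  · obtain ⟨μ', h⟩ := h
    rw [edgePart_of h, edgePart_of h, vertexPart_apply_eq h.range_eq.symm]
  · rw [edgePart_not h, edgePart_not h]

theorem source_edge_part (e : X) (p : c.paths → K) :
    vertexPart K c (E.s e) (edgePart K c e p) = edgePart K c e p := by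
  ext μ
  by_cases h : ∃ μ' : c.paths, IsCons e μ'.1 μ.1
  · obtain ⟨μ', h⟩ := h
    rw [vertexPart_apply_eq h.source_eq]
  · by_cases h' : μ.1.source = E.s e
    · rw [vertexPart_apply_eq h']
    · rw [vertexPart_apply_ne h', edgePart_not h]

theorem ghost_source_part (e : X) (p : c.paths → K) :
    ghostPart K c e (vertexPart K c (E.s e) p) = ghostPart K c e p := by
  ext μ'
  by_cases h : ∃ μ : c.paths, IsCons e μ'.1 μ.1
  · obtain ⟨μ, h⟩ := h
    rw [ghostPart_of h, ghostPart_of h, vertexPart_apply_eq h.source_eq]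
  · rw [ghostPart_not h, ghostPart_not h]

theorem range_ghost_part (e : X) (p : c.paths → K) :
    vertexPart K c (E.r e) (ghostPart K c e p) = ghostPart K c e p := by
  ext μ'
  by_cases h : ∃ μ : c.paths, IsCons e μ'.1 μ.1
  · obtain ⟨μ, h⟩ := h
    rw [vertexPart_apply_eq h.range_eq.symm]
  · by_cases h' : μ'.1.source = E.r e
    · rw [vertexPart_apply_eq h']
    · rw [vertexPart_apply_ne h', ghostPart_not h]

open scoped Classical in
theorem vertexPart_single (v : V) (μ : c.paths) (y : K) (h : μ.1.source = v) :
    vertexPart K c v (Pi.single μ y) = Pi.single μ y := by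
  ext μ'
  by_cases h' : μ'.1.source = v
  · rw [vertexPart_apply_eq h']
  · rw [vertexPart_apply_ne h', Pi.single_eq_of_ne]
    rintro rfl
    exact h' h

theorem source_wrap_part (e : X) (p : c.paths → K) :
    vertexPart K c (E.s e) (wrapPart K c e p) = wrapPart K c e p := by
  classical
  by_cases h : ∃ ν : c.paths, IsCons e ν.1 c.toFinPath
  · obtain ⟨ν, h⟩ := h
    rw [wrapPart_of h, vertexPart_single _ _ _ h.source_eq]
  · simp [wrapPart_not h]

theorem wrap_range_part (e : X) (p : c.paths → K) :
    wrapPart K c e (vertexPart K c (E.r e) p) = wrapPart K c e p := by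
  classical
  by_cases h : ∃ ν : c.paths, IsCons e ν.1 c.toFinPath
  · obtain ⟨ν, h⟩ := h
    rw [wrapPart_of h, wrapPart_of h, vertexPart_apply_eq h.range_eq.symm]
  · simp [wrapPart_not h]

theorem range_unwrap_part (e : X) (p : c.paths → K) :
    vertexPart K c (E.r e) (unwrapPart K c e p) = unwrapPart K c e p := by
  classical
  by_cases h : ∃ ν : c.paths, IsCons e ν.1 c.toFinPath
  · obtain ⟨ν, h⟩ := h
    rw [unwrapPart_of h, vertexPart_single _ _ _ h.range_eq.symm]
  · simp [unwrapPart_not h]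

theorem unwrap_source_part (e : X) (p : c.paths → K) :
    unwrapPart K c e (vertexPart K c (E.s e) p) = unwrapPart K c e p := by
  classical
  by_cases h : ∃ ν : c.paths, IsCons e ν.1 c.toFinPath
  · obtain ⟨ν, h⟩ := h
    rw [unwrapPart_of h, unwrapPart_of h, vertexPart_apply_eq h.source_eq]
  · simp [unwrapPart_not h]

theorem unwrap_edge_part (e f : X) (p : c.paths → K) :
    unwrapPart K c f (edgePart K c e p) = 0 := by
  classical
  by_cases h : ∃ ν : c.paths, IsCons f ν.1 c.toFinPath
  · obtain ⟨ν, h⟩ := h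
    rw [unwrapPart_of h, edgePart_not, Pi.single_zero]
    rintro ⟨_, h'⟩
    exact not_isCons_basePath h'
  · simp [unwrapPart_not h]

theorem ghost_wrap_part (e f : X) (p : c.paths → K) :
    ghostPart K c f (wrapPart K c e p) = 0 := by
  classical
  by_cases h : ∃ ν : c.paths, IsCons e ν.1 c.toFinPath
  · obtain ⟨ν, h⟩ := h
    rw [wrapPart_of h]
    ext μ'
    by_cases h' : ∃ μ : c.paths, IsCons f μ'.1 μ.1
    · obtain ⟨μ, h'⟩ := h'
      rw [ghostPart_of h', Pi.single_eq_of_ne]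
      · rfl
      · rintro rfl
        exact not_isCons_basePath h'
    · rw [ghostPart_not h']; rfl
  · simp [wrapPart_not h]

theorem wrap_ghost_part (e : X) (p : c.paths → K) :
    wrapPart K c e (ghostPart K c e p) = 0 := by
  classical
  by_cases h : ∃ ν : c.paths, IsCons e ν.1 c.toFinPath
  · obtain ⟨ν, h⟩ := h
    rw [wrapPart_of h, ghostPart_not, Pi.single_zero]
    rintro ⟨μ, h'⟩
    exact ne_cycle (isProper_of_isCons h) μ (isCons_right_unique h' h)
  · simp [wrapPart_not h]

theorem edge_unwrap_part (e : X) (p : c.paths → K) :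
    edgePart K c e (unwrapPart K c e p) = 0 := by
  classical
  by_cases h : ∃ ν : c.paths, IsCons e ν.1 c.toFinPath
  · obtain ⟨ν, h⟩ := h
    rw [unwrapPart_of h]
    ext μ
    by_cases h' : ∃ μ' : c.paths, IsCons e μ'.1 μ.1
    · obtain ⟨μ', h'⟩ := h'
      rw [edgePart_of h', Pi.single_eq_of_ne]
      · rfl
      · rintro rfl
        exact ne_cycle (isProper_of_isCons h) μ (isCons_right_unique h' h)
    · rw [edgePart_not h']; rfl
  · simp [unwrapPart_not h]

theorem ghost_edge_part_ne {e f : X} (hef : e ≠ f) (p : c.paths → K) :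
    ghostPart K c e (edgePart K c f p) = 0 := by
  ext μ'
  by_cases h : ∃ μ : c.paths, IsCons e μ'.1 μ.1
  · obtain ⟨μ, h⟩ := h
    rw [ghostPart_of h, edgePart_not]
    · rfl
    · rintro ⟨ν, h'⟩
      exact hef (isCons_left_unique h h').1
  · rw [ghostPart_not h]; rfl

theorem unwrap_wrap_part_ne {e f : X} (hef : e ≠ f) (p : c.paths → K) :
    unwrapPart K c e (wrapPart K c f p) = 0 := by
  by_cases h : ∃ ν : c.paths, IsCons e ν.1 c.toFinPath
  · by_cases h' : ∃ ν : c.paths, IsCons f ν.1 c.toFinPath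
    · obtain ⟨ν, h⟩ := h
      obtain ⟨ν', h'⟩ := h'
      exact absurd (isCons_left_unique h h').1 hef
    · simp [wrapPart_not h']
  · simp [unwrapPart_not h]

theorem suffix_cons_eq {α : Type*} {l m : List α} {y : α} (h : l <:+ y :: m) (h' : ¬ l <:+ m) :
    l = y :: m := by
  rcases List.suffix_cons_iff.mp h with h | h
  · exact h
  · exact absurd h h'

theorem ghost_edge_part_self (e : X) (p : c.paths → K) :
    ghostPart K c e (edgePart K c e p) + unwrapPart K c e (wrapPart K c e p)
      = vertexPart K c (E.r e) p := by
  classical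
  ext μ'
  rw [Pi.add_apply]
  by_cases hr : E.r e = μ'.1.source
  · rw [vertexPart_apply_eq hr.symm]
    let μ : E.FinPath := ⟨E.s e, e :: μ'.1.edges, rfl, by rw [hr]; exact μ'.1.isWalk⟩
    have hμ : IsCons e μ'.1 μ := ⟨rfl, hr, rfl⟩
    have hrange : μ.range = c.source := by
      have : μ.range = E.endpoint (E.r e) μ'.1.edges := rfl
      rw [this, hr]
      exact μ'.2.1
    by_cases hm : μ ∈ c.paths
    · have hμ' : IsCons e μ'.1 (⟨μ, hm⟩ : c.paths).1 := hμ
      rw [ghostPart_of hμ', edgePart_of hμ']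
      by_cases h : ∃ ν : c.paths, IsCons e ν.1 c.toFinPath
      · obtain ⟨ν, h⟩ := h
        rw [unwrapPart_of h, Pi.single_eq_of_ne, add_zero]
        rintro rfl
        exact ne_cycle (isProper_of_isCons h) ⟨μ, hm⟩ (isCons_right_unique hμ' h)
      · simp [unwrapPart_not h]
    · have hc : IsCons e μ'.1 c.toFinPath := by
        have h2 : c.IsProper ∧ c.edges <:+ μ.edges := by
          by_contra hcon
          exact hm ⟨hrange, fun hc hs => hcon ⟨hc, hs⟩⟩
        have h3 : c.edges = e :: μ'.1.edges := suffix_cons_eq h2.2 (μ'.2.2 h2.1)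
        have h4 : c.source = E.s e := by
          have := c.isWalk
          rw [h3] at this
          exact this.1.symm
        exact ⟨h4, hr, h3⟩
      rw [unwrapPart_of hc, wrapPart_of hc, Pi.single_eq_same, Pi.single_eq_same, ghostPart_not,
        zero_add]
      rintro ⟨μ₂, h₂⟩
      exact hm (isCons_right_unique h₂ hμ ▸ μ₂.2)
  · rw [vertexPart_apply_ne (Ne.symm hr), ghostPart_not, zero_add]
    · by_cases h : ∃ ν : c.paths, IsCons e ν.1 c.toFinPath
      · obtain ⟨ν, h⟩ := h
        rw [unwrapPart_of h, Pi.single_eq_of_ne]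
        rintro rfl
        exact hr h.range_eq
      · simp [unwrapPart_not h]
    · rintro ⟨μ, h⟩
      exact hr h.range_eq

theorem wrap_unwrap_part_of {e : X} {ν : c.paths} (h : IsCons e ν.1 c.toFinPath)
    (p : c.paths → K) : wrapPart K c e (unwrapPart K c e p) c.basePath = p c.basePath := by
  classical
  rw [wrapPart_of h, unwrapPart_of h, Pi.single_eq_same, Pi.single_eq_same]

theorem wrap_part_ne (e : X) (p : c.paths → K) {μ : c.paths} (hμ : μ ≠ c.basePath) :
    wrapPart K c e p μ = 0 := by
  classical
  by_cases h : ∃ ν : c.paths, IsCons e ν.1 c.toFinPath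
  · obtain ⟨ν, h⟩ := h
    rw [wrapPart_of h, Pi.single_eq_of_ne hμ]
  · simp [wrapPart_not h]

theorem sum_part [Fintype X] [DecidableEq V] (v : V) (hv : ¬ E.IsSink v) (p : c.paths → K) :
    vertexPart K c v p = ∑ e : {e : X // E.s e = v},
      (edgePart K c e.1 (ghostPart K c e.1 p) + wrapPart K c e.1 (unwrapPart K c e.1 p)) := by
  classical
  ext μ
  rw [Finset.sum_apply]
  simp only [Pi.add_apply]
  by_cases hs : μ.1.source = v
  · rw [vertexPart_apply_eq hs]
    by_cases hb : μ = c.basePath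
    · subst hb
      have hs' : c.source = v := hs
      have hc : c.IsProper := fun h => hv (hs' ▸ c.sink_of_nil h)
      obtain ⟨e, ν, h⟩ := exists_tail (c := c) c.toFinPath c.closed (fun _ _ => rfl) hc
      have he : E.s e = v := h.source_eq.symm.trans hs'
      rw [Finset.sum_eq_single ⟨e, he⟩]
      · rw [edgePart_not, zero_add, wrap_unwrap_part_of h]
        rintro ⟨_, h'⟩
        exact not_isCons_basePath h'
      · rintro ⟨f, hf⟩ _ hne
        rw [edgePart_not, zero_add, wrapPart_not]
        · rfl
        · rintro ⟨_, h'⟩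
          exact hne (Subtype.ext (isCons_left_unique h' h).1)
        · rintro ⟨_, h'⟩
          exact not_isCons_basePath h'
      · simp
    · have hne : μ.1.edges ≠ [] := by
        intro h0
        apply hb
        apply Subtype.ext
        refine FinPath.ext ?_ h0
        have hr := μ.2.1
        unfold FinPath.range at hr
        rw [h0] at hr
        exact hr
      obtain ⟨e, μ', h⟩ := exists_tail (c := c) μ.1 μ.2.1
        (fun hc hs => absurd hs (μ.2.2 hc)) hne
      have he : E.s e = v := h.source_eq.symm.trans hs
      rw [Finset.sum_eq_single ⟨e, he⟩]
      · rw [edgePart_of h, ghostPart_of h, wrap_part_ne _ _ hb, add_zero]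
      · rintro ⟨f, hf⟩ _ hne
        rw [wrap_part_ne _ _ hb, add_zero, edgePart_not]
        rintro ⟨_, h'⟩
        exact hne (Subtype.ext (isCons_left_unique h' h).1)
      · simp
  · rw [vertexPart_apply_ne hs, Finset.sum_eq_zero]
    rintro ⟨e, he⟩ _
    have h1 := congrFun (source_edge_part (K := K) (c := c) e (ghostPart K c e p)) μ
    have h2 := congrFun (source_wrap_part (K := K) (c := c) e (unwrapPart K c e p)) μ
    rw [he, vertexPart_apply_ne hs] at h1 h2
    rw [← h1, ← h2, add_zero]

theorem vertex_part_idem (v : V) (p : c.paths → K) :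
    vertexPart K c v (vertexPart K c v p) = vertexPart K c v p := by
  ext μ
  by_cases h : μ.1.source = v
  · rw [vertexPart_apply_eq h]
  · rw [vertexPart_apply_ne h, vertexPart_apply_ne h]

theorem vertex_part_orth {v v' : V} (hv : v ≠ v') (p : c.paths → K) :
    vertexPart K c v (vertexPart K c v' p) = 0 := by
  ext μ
  by_cases h : μ.1.source = v
  · rw [vertexPart_apply_eq h, vertexPart_apply_ne (h.trans_ne hv)]
    rfl
  · rw [vertexPart_apply_ne h]
    rfl

theorem sum_vertex_part [Fintype V] (p : c.paths → K) : ∑ v, vertexPart K c v p = p := by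
  classical
  ext μ
  rw [Finset.sum_apply, Finset.sum_eq_single μ.1.source]
  · exact vertexPart_apply_eq rfl p
  · intro v _ hne
    exact vertexPart_apply_ne hne.symm p
  · simp

theorem alpha_of_mem {j : ℕ} (h : j ∈ c.indexSet) : alpha K c j = incl K c ⟨j, h⟩ := dif_pos h

theorem alpha_of_not_mem {j : ℕ} (h : j ∉ c.indexSet) : alpha K c j = 0 := dif_neg h

theorem end_ext {F G : Module.End K (FormalPrufer K c)}
    (h : ∀ j p, F (alpha K c j p) = G (alpha K c j p)) : F = G := by
  refine Finsupp.lhom_ext' fun j => LinearMap.ext fun p => ?_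
  have h' := h j.1 p
  rw [alpha_of_mem j.2] at h'
  exact h'

theorem liftLin_alpha (F : ℕ → (c.paths → K) →ₗ[K] FormalPrufer K c)
    (hF : ∀ j, j ∉ c.indexSet → F j = 0) (j : ℕ) (p : c.paths → K) :
    liftLin F (alpha K c j p) = F j p := by
  by_cases h : j ∈ c.indexSet
  · rw [alpha_of_mem h]
    exact (Finsupp.lsum_single K (fun j : c.indexSet => F j.1) ⟨j, h⟩ p)
  · rw [hF j h, alpha_of_not_mem h]
    simp

theorem alpha_zero : alpha K c 0 = 0 := alpha_of_not_mem fun h => absurd h.1 (by simp)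

theorem not_isProper_or_eq_zero {j : ℕ} (h : j ∉ c.indexSet) : ¬ c.IsProper ∨ j = 0 := by
  by_contra hcon
  push Not at hcon
  exact h ⟨Nat.one_le_iff_ne_zero.mpr hcon.2, fun hc => absurd hcon.1 hc⟩

theorem vertexAct_alpha (v : V) (j : ℕ) (p : c.paths → K) :
    vertexAct K c v (alpha K c j p) = alpha K c j (vertexPart K c v p) :=
  liftLin_alpha _ (fun j h => by rw [alpha_of_not_mem h, LinearMap.zero_comp]) j p

theorem edgeAct_alpha (e : X) (j : ℕ) (p : c.paths → K) :
    edgeAct K c e (alpha K c j p) = alpha K c j (edgePart K c e p)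
      + (alpha K c j (wrapPart K c e p) + alpha K c (j - 1) (wrapPart K c e p)) :=
  liftLin_alpha _ (fun j h => by
    rcases not_isProper_or_eq_zero h with hc | rfl
    · rw [alpha_of_not_mem h, wrapPart_not fun ⟨_, h'⟩ => hc (isProper_of_isCons h')]
      simp
    · simp [alpha_zero]) j p

variable (K c) in
/-- `∑_{l < j} (-1)^l α_{j-l}` -/
def altAlpha (j : ℕ) : (c.paths → K) →ₗ[K] FormalPrufer K c :=
  ∑ l ∈ Finset.range j, (-1 : K) ^ l • alpha K c (j - l)

theorem altAlpha_succ (j : ℕ) : altAlpha K c (j + 1) = alpha K c (j + 1) - altAlpha K c j := by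
  unfold altAlpha
  rw [Finset.sum_range_succ', add_comm, sub_eq_add_neg, ← Finset.sum_neg_distrib]
  simp [pow_succ]

theorem altAlpha_zero : altAlpha K c 0 = 0 := by simp [altAlpha]

theorem altAlpha_add (j : ℕ) : altAlpha K c j + altAlpha K c (j - 1) = alpha K c j := by
  cases j with
  | zero => simp [altAlpha_zero, alpha_zero]
  | succ j => rw [altAlpha_succ]; simp

theorem ghostAct_alpha (e : X) (j : ℕ) (p : c.paths → K) :
    ghostAct K c e (alpha K c j p) = alpha K c j (ghostPart K c e p)
      + altAlpha K c j (unwrapPart K c e p) :=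
  liftLin_alpha _ (fun j h => by
    rcases not_isProper_or_eq_zero h with hc | rfl
    · rw [alpha_of_not_mem h, unwrapPart_not fun ⟨_, h'⟩ => hc (isProper_of_isCons h')]
      simp
    · simp [alpha_zero]) j p

theorem vertexAct_altAlpha (v : V) (j : ℕ) (p : c.paths → K) :
    vertexAct K c v (altAlpha K c j p) = altAlpha K c j (vertexPart K c v p) := by
  induction j with
  | zero => simp [altAlpha_zero]
  | succ j ih => simp [altAlpha_succ, vertexAct_alpha, ih]

theorem edgeAct_altAlpha (e : X) (j : ℕ) (p : c.paths → K) :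
    edgeAct K c e (altAlpha K c j p) = altAlpha K c j (edgePart K c e p)
      + alpha K c j (wrapPart K c e p) := by
  induction j with
  | zero => simp [altAlpha_zero, alpha_zero]
  | succ j ih =>
    simp only [altAlpha_succ, LinearMap.sub_apply, map_sub, edgeAct_alpha, ih,
      Nat.add_sub_cancel]
    abel

variable (K c) in
/-- The `K`-algebra homomorphism `L_K(E) → End_K(Û)` given by the Cuntz–Krieger `E`-family of the
above operators. -/
def actHom [Finite V] [Finite X] : E.LPA K →ₐ[K] Module.End K (FormalPrufer K c) :=
  liftLPA (vertexAct K c) (edgeAct K c) (ghostAct K c)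
    (by
      have := Fintype.ofFinite V
      rw [finsum_eq_sum_of_fintype]
      refine end_ext fun j p => ?_
      simp only [LinearMap.sum_apply, vertexAct_alpha, ← map_sum, sum_vertex_part,
        Module.End.one_apply])
    (fun v => end_ext fun j p => by
      simp only [Module.End.mul_apply, vertexAct_alpha, vertex_part_idem])
    (fun v v' h => end_ext fun j p => by
      simp only [Module.End.mul_apply, vertexAct_alpha, vertex_part_orth h, map_zero,
        LinearMap.zero_apply])
    (fun e => end_ext fun j p => by
      simp only [Module.End.mul_apply, vertexAct_alpha, edgeAct_alpha, map_add,
        source_edge_part, source_wrap_part])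
    (fun e => end_ext fun j p => by
      simp only [Module.End.mul_apply, vertexAct_alpha, edgeAct_alpha,
        edge_range_part, wrap_range_part])
    (fun e => end_ext fun j p => by
      simp only [Module.End.mul_apply, vertexAct_alpha, ghostAct_alpha, map_add,
        vertexAct_altAlpha, range_ghost_part, range_unwrap_part])
    (fun e => end_ext fun j p => by
      simp only [Module.End.mul_apply, vertexAct_alpha, ghostAct_alpha,
        ghost_source_part, unwrap_source_part])
    (fun e => end_ext fun j p => by
      simp only [Module.End.mul_apply, vertexAct_alpha, ghostAct_alpha, edgeAct_alpha, map_add,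
        unwrap_edge_part, ghost_wrap_part, map_zero, add_zero, zero_add]
      rw [← ghost_edge_part_self, map_add, ← altAlpha_add j, LinearMap.add_apply,
        LinearMap.add_apply])
    (fun e f h => end_ext fun j p => by
      simp only [Module.End.mul_apply, ghostAct_alpha, edgeAct_alpha, map_add,
        unwrap_edge_part, ghost_wrap_part, ghost_edge_part_ne h, unwrap_wrap_part_ne h, map_zero,
        add_zero, LinearMap.zero_apply])
    (fun v h => by
      classical
      have := Fintype.ofFinite X
      rw [finsum_eq_sum_of_fintype]
      refine end_ext fun j p => ?_
      simp only [LinearMap.sum_apply, Module.End.mul_apply, vertexAct_alpha, ghostAct_alpha,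
        edgeAct_alpha, map_add, edgeAct_altAlpha, wrap_ghost_part, edge_unwrap_part, map_zero,
        add_zero, zero_add, sum_part v h, map_sum])

/-- The left `L_K(E)`-module structure of `Û_{E,c-1}`. -/
instance instModuleLPA [Finite V] [Finite X] : Module (E.LPA K) (FormalPrufer K c) :=
  Module.compHom (FormalPrufer K c) (actHom K c).toRingHom

end FormalPrufer

end DirGraph

end FormalPrufer

section Tensor

open TensorProduct

variable (A : Type a) (B : Type b) [Ring A] [Ring B]
  (X : Type x) [AddCommGroup X] [Module A X] [Module Bᵐᵒᵖ X] [SMulCommClass A Bᵐᵒᵖ X]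

/-- The subgroup of `X ⊗_ℤ M` generated by the elements `x b ⊗ m - x ⊗ b m`, for an
`(A, B)`-bimodule `X` and a left `B`-module `M`. It is stable under `A`, as
`a (x b ⊗ m - x ⊗ b m) = (a x) b ⊗ m - (a x) ⊗ b m`. -/
def balancedRelations (M : Type t) [AddCommGroup M] [Module B M] : Submodule A (X ⊗[ℤ] M) :=
  Submodule.span A
    {z | ∃ (y : X) (r : B) (m : M), z = (MulOpposite.op r • y) ⊗ₜ[ℤ] m - y ⊗ₜ[ℤ] (r • m)}

/-- The tensor product `X ⊗_B M` over the (noncommutative) ring `B` of an `(A, B)`-bimodule `X` and a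
left `B`-module `M`, with its left `A`-module structure. -/
abbrev BimoduleTensor (M : Type t) [AddCommGroup M] [Module B M] : Type (max x t) :=
  (X ⊗[ℤ] M) ⧸ balancedRelations A B X M

/-- The map `X ⊗_B f`. -/
def BimoduleTensor.map {M N : Type*} [AddCommGroup M] [Module B M] [AddCommGroup N] [Module B N]
    (f : M →ₗ[B] N) : BimoduleTensor A B X M →ₗ[A] BimoduleTensor A B X N :=
  Submodule.mapQ _ _
    (TensorProduct.AlgebraTensorModule.map (LinearMap.id : X →ₗ[A] X)
      f.toAddMonoidHom.toIntLinearMap) (by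
      unfold balancedRelations
      rw [Submodule.span_le]
      rintro _ ⟨y, r, m, rfl⟩
      apply Submodule.subset_span
      exact ⟨y, r, f m, by simp⟩)

open CategoryTheory in
/-- The functor `X ⊗_B - : B-Mod ⥤ A-Mod`. -/
def bimoduleTensorFunctor : ModuleCat.{max x t} B ⥤ ModuleCat.{max x t} A where
  obj M := ModuleCat.of A (BimoduleTensor A B X M)
  map f := ModuleCat.ofHom (BimoduleTensor.map A B X f.hom)
  map_id M := by
    refine ModuleCat.hom_ext (LinearMap.ext fun z => ?_)
    obtain ⟨z, rfl⟩ := Submodule.Quotient.mk_surjective _ z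
    induction z with
    | zero => simp
    | tmul y m => rfl
    | add z₁ z₂ h₁ h₂ => rw [Submodule.Quotient.mk_add, map_add, map_add, h₁, h₂]
  map_comp f g := by
    refine ModuleCat.hom_ext (LinearMap.ext fun z => ?_)
    obtain ⟨z, rfl⟩ := Submodule.Quotient.mk_surjective _ z
    induction z with
    | zero => simp
    | tmul y m => rfl
    | add z₁ z₂ h₁ h₂ => rw [Submodule.Quotient.mk_add, map_add, map_add, h₁, h₂]

end Tensor

section Corners

variable {A : Type a} [Ring A] {ε : A} (hε : IsIdempotentElem ε)

namespace IsIdempotentElem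

/-- The `K`-algebra structure of the corner ring `εAε`. -/
instance instAlgebraCorner (K : Type k) [Field K] [Algebra K A] : Algebra K hε.Corner where
  smul r y := ⟨r • y.1, by
    obtain ⟨_, z, rfl⟩ := y
    exact ⟨r • z, by simp⟩⟩
  algebraMap :=
    { toFun := fun r => ⟨r • ε, r • ε, by simp [hε.eq]⟩
      map_one' := Subtype.ext (one_smul K ε)
      map_mul' := fun r r' => Subtype.ext (by
        change (r * r') • ε = (r • ε) * (r' • ε)
        rw [smul_mul_smul_comm, hε.eq])
      map_zero' := Subtype.ext (zero_smul K ε)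
      map_add' := fun r r' => Subtype.ext (add_smul r r' ε) }
  commutes' r y := Subtype.ext (by
    have h := (Subsemigroup.mem_corner_iff hε).mp y.2
    change (r • ε) * y.1 = y.1 * (r • ε)
    rw [smul_mul_assoc, mul_smul_comm, h.1, h.2])
  smul_def' r y := Subtype.ext (by
    have h := (Subsemigroup.mem_corner_iff hε).mp y.2
    change r • y.1 = (r • ε) * y.1
    rw [smul_mul_assoc, h.1])

/-- The left ideal `Aε = {y | yε = y}`. -/
def leftIdeal (_ : IsIdempotentElem ε) : Submodule A A where
  carrier := {y | y * ε = y}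
  add_mem' {y z} hy hz := by
    change (y + z) * ε = y + z
    rw [add_mul, show y * ε = y from hy, show z * ε = z from hz]
  zero_mem' := zero_mul ε
  smul_mem' r y hy := by
    change r * y * ε = r * y
    rw [mul_assoc, show y * ε = y from hy]

/-- The right ideal `εA = {y | εy = y}`. -/
def rightIdeal (_ : IsIdempotentElem ε) : Submodule Aᵐᵒᵖ A where
  carrier := {y | ε * y = y}
  add_mem' {y z} hy hz := by
    change ε * (y + z) = y + z
    rw [mul_add, show ε * y = y from hy, show ε * z = z from hz]
  zero_mem' := mul_zero ε
  smul_mem' r y hy := by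
    change ε * (y * r.unop) = y * r.unop
    rw [← mul_assoc, show ε * y = y from hy]

/-- `εAε` acts on `Aε` by right multiplication. -/
instance instModuleLeftIdeal : Module (hε.Corner)ᵐᵒᵖ hε.leftIdeal where
  smul r y := ⟨y.1 * r.unop.1, by
    change y.1 * r.unop.1 * ε = y.1 * r.unop.1
    rw [mul_assoc, ((Subsemigroup.mem_corner_iff hε).mp r.unop.2).2]⟩
  one_smul y := Subtype.ext y.2
  mul_smul r r' y := Subtype.ext (mul_assoc y.1 r'.unop.1 r.unop.1).symm
  smul_zero r := Subtype.ext (zero_mul r.unop.1)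
  smul_add r y z := Subtype.ext (add_mul y.1 z.1 r.unop.1)
  add_smul r r' y := Subtype.ext (mul_add y.1 r.unop.1 r'.unop.1)
  zero_smul y := Subtype.ext (mul_zero y.1)

instance : SMulCommClass A (hε.Corner)ᵐᵒᵖ hε.leftIdeal where
  smul_comm r r' y := Subtype.ext (mul_assoc r y.1 r'.unop.1).symm

/-- `εAε` acts on `εA` by left multiplication. -/
instance instModuleRightIdeal : Module hε.Corner hε.rightIdeal where
  smul r y := ⟨r.1 * y.1, by
    change ε * (r.1 * y.1) = r.1 * y.1
    rw [← mul_assoc, ((Subsemigroup.mem_corner_iff hε).mp r.2).1]⟩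
  one_smul y := Subtype.ext y.2
  mul_smul r r' y := Subtype.ext (mul_assoc r.1 r'.1 y.1)
  smul_zero r := Subtype.ext (mul_zero r.1)
  smul_add r y z := Subtype.ext (mul_add r.1 y.1 z.1)
  add_smul r r' y := Subtype.ext (add_mul r.1 r'.1 y.1)
  zero_smul y := Subtype.ext (zero_mul y.1)

instance : SMulCommClass hε.Corner Aᵐᵒᵖ hε.rightIdeal where
  smul_comm r r' y := Subtype.ext (mul_assoc r.1 y.1 r'.unop).symm

end IsIdempotentElem

end Corners

end

/-! Write `A` for L_K(E), `H` for the set of vertices other than `u₀`, and `ε` for their sum in `A`,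
so that 1 = ε + u₀.

Fullness. As `u₀` is not a sink, u₀ = ∑ e e* over the edges leaving it; as it is a source, these
edges end in `H`, whence e e* = e ε e*. So 1 lies in AεA (`IsSource.isFull_vertexSum`). For any full
idempotent the functors εA ⊗ - and Aε ⊗ - are mutually inverse. Only the isomorphism Aε ⊗ εA ⊗ M ≅ M
uses fullness (`IsFull.bijective_leftTensorHom`); the isomorphism εA ⊗ Aε ⊗ N ≅ N holds for every
idempotent (`bijective_rightLeftTensorHom`).

The corner. The vertices in `H` and the edges and ghosts with source in `H` satisfy the relations of
E_H inside εAε, which gives `restrictHom`. It is onto because a product of generators with both ends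
in `H` can visit `u₀` only through factors e* e with s(e) = u₀, and these reduce to r(e) or 0
(`IsSource.surjective_restrictHom`). It is injective because `A` acts on L_K(E_H) ⊕ ⨁ r(e) L_K(E_H),
a model of Aε, in such a way that the image of y sends (1, 0) to (y, 0) (`spaceHom_restrictHom`).

The modules. A cycle cannot be based at `u₀`: a proper one would supply an edge ending there, and
`u₀` is not a sink. As `H` is hereditary, the paths of 𝒫_c starting in `H` are exactly those of E_H.
Extension of formal series by zero therefore identifies Û over E_H with ε Û over E, compatibly with
the two actions (`pruferIncl_smul`, `mem_range_pruferIncl_iff`), and fullness recovers Û from ε Û as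
Aε ⊗ ε Û. -/

noncomputable section

/-! ### Tensor products over a noncommutative ring: pure tensors and maps out. -/

section TensorLift

open TensorProduct

namespace BimoduleTensor

variable (A : Type a) (B : Type b) [Ring A] [Ring B]
  {X : Type x} [AddCommGroup X] [Module A X] [Module Bᵐᵒᵖ X]
  {M : Type t} [AddCommGroup M] [Module B M]

/-- The class of `y ⊗ m` in `X ⊗_B M`. -/
def tmul (y : X) (m : M) : BimoduleTensor A B X M :=
  Submodule.Quotient.mk (y ⊗ₜ[ℤ] m)

variable {A B}

theorem tmul_add (y : X) (m m' : M) : tmul A B y (m + m') = tmul A B y m + tmul A B y m' := by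
  simp only [tmul, TensorProduct.tmul_add, Submodule.Quotient.mk_add]

theorem tmul_zero (y : X) : tmul A B y (0 : M) = 0 := by
  simp only [tmul, TensorProduct.tmul_zero, Submodule.Quotient.mk_zero]

theorem smul_tmul' (r : A) (y : X) (m : M) : r • tmul A B y m = tmul A B (r • y) m := rfl

theorem op_smul_tmul (r : B) (y : X) (m : M) :
    tmul A B (MulOpposite.op r • y) m = tmul A B y (r • m) :=
  (Submodule.Quotient.eq _).mpr (Submodule.subset_span ⟨y, r, m, rfl⟩)

@[elab_as_elim]
theorem induction_on {motive : BimoduleTensor A B X M → Prop} (z : BimoduleTensor A B X M)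
    (zero : motive 0) (tmul : ∀ y m, motive (tmul A B y m))
    (add : ∀ z z', motive z → motive z' → motive (z + z')) : motive z := by
  obtain ⟨z, rfl⟩ := Submodule.Quotient.mk_surjective _ z
  induction z with
  | zero => exact zero
  | tmul y m => exact tmul y m
  | add z z' h h' => exact add _ _ h h'

variable {P : Type*} [AddCommGroup P] [Module A P]

/-- The `A`-linear map out of `X ⊗_B M` induced by a balanced biadditive map. -/
def lift (f : X →ₗ[A] M →ₗ[ℤ] P)
    (hf : ∀ (r : B) y m, f (MulOpposite.op r • y) m = f y (r • m)) :
    BimoduleTensor A B X M →ₗ[A] P :=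
  Submodule.liftQ _ (TensorProduct.AlgebraTensorModule.lift f) (by
    unfold balancedRelations
    rw [Submodule.span_le]
    rintro _ ⟨y, r, m, rfl⟩
    simp [hf])

/-- The additive map out of `X ⊗_B M` induced by a balanced biadditive map. -/
def liftAdd [SMulCommClass A Bᵐᵒᵖ X] {Q : Type*} [AddCommGroup Q] (f : X →ₗ[ℤ] M →ₗ[ℤ] Q)
    (hf : ∀ (r : B) y m, f (MulOpposite.op r • y) m = f y (r • m)) :
    BimoduleTensor A B X M →+ Q :=
  QuotientAddGroup.lift (balancedRelations A B X M).toAddSubgroup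
    (TensorProduct.lift f).toAddMonoidHom (by
    intro z hz
    -- The relations are an `A`-span while `f` is only additive, so vanishing at z alone does not
    -- pass through the scalar step of the induction; vanishing at all multiples of z does. A
    -- multiple of a generator is again a generator because the two actions on `X` commute.
    suffices h : ∀ a : A, TensorProduct.lift f (a • z) = 0 by
      simpa using h 1
    induction hz using Submodule.span_induction with
    | mem z hz =>
      obtain ⟨y, r, m, rfl⟩ := hz
      intro a
      rw [smul_sub, TensorProduct.smul_tmul', TensorProduct.smul_tmul', smul_comm, map_sub,
        sub_eq_zero]
      exact hf r (a • y) m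
    | zero => simp
    | add z z' _ _ h h' => intro a; rw [smul_add, map_add, h, h', add_zero]
    | smul b z _ h => intro a; rw [← mul_smul]; exact h _)

theorem map_tmul {N : Type*} [AddCommGroup N] [Module B N] (g : M →ₗ[B] N) (y : X) (m : M) :
    map A B X g (tmul A B y m) = tmul A B y (g m) := rfl

end BimoduleTensor

end TensorLift

/-! ### Full idempotents and the Morita equivalence with the corner ring. -/

namespace IsIdempotentElem

open BimoduleTensor

variable {A : Type a} [Ring A] {ε : A} (hε : IsIdempotentElem ε)

/-- The idempotent `ε` as an element of `Aε`. -/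
def leftUnit : hε.leftIdeal := ⟨ε, hε⟩

/-- The idempotent `ε` as an element of `εA`. -/
def rightUnit : hε.rightIdeal := ⟨ε, hε⟩

/-- The element `ε y z ε` of the corner ring, for `y ∈ εA` and `z ∈ Aε`. -/
def cornerMul (y : hε.rightIdeal) (z : hε.leftIdeal) : hε.Corner :=
  ⟨y.1 * z.1, (Subsemigroup.mem_corner_iff hε).mpr
    ⟨by rw [← mul_assoc, show ε * y.1 = y.1 from y.2],
      by rw [mul_assoc, show z.1 * ε = z.1 from z.2]⟩⟩

/-- An idempotent `ε` is full if `AεA = A`. -/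
def IsFull (_ : IsIdempotentElem ε) : Prop :=
  (1 : A) ∈ AddSubgroup.closure (Set.range fun p : A × A => p.1 * ε * p.2)

variable {hε}

/-- Write 1 as a sum of terms ±aεb: each of them kills z. Together with the next lemma this lets
injectivity and surjectivity be tested after multiplication by `ε`. -/
theorem IsFull.eq_zero (hfull : hε.IsFull) {M : Type*} [AddCommGroup M] [Module A M] {z : M}
    (h : ∀ y : A, (ε * y) • z = 0) : z = 0 := by
  have key : ∀ r ∈ AddSubgroup.closure (Set.range fun p : A × A => p.1 * ε * p.2),
      r • z = 0 := by
    intro r hr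
    induction hr using AddSubgroup.closure_induction with
    | mem _ hr =>
      obtain ⟨p, rfl⟩ := hr
      simp only [mul_assoc, mul_smul p.1, h, smul_zero]
    | zero => exact zero_smul _ _
    | add _ _ _ _ h₁ h₂ => rw [add_smul, h₁, h₂, add_zero]
    | neg _ _ h₁ => rw [neg_smul, h₁, neg_zero]
  simpa using key 1 hfull

theorem IsFull.mem_submodule (hfull : hε.IsFull) {M : Type*} [AddCommGroup M] [Module A M]
    (S : Submodule A M) (h : ∀ m : M, ε • m ∈ S) (m : M) : m ∈ S := by
  have key : ∀ r ∈ AddSubgroup.closure (Set.range fun p : A × A => p.1 * ε * p.2),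
      r • m ∈ S := by
    intro r hr
    induction hr using AddSubgroup.closure_induction with
    | mem _ hr =>
      obtain ⟨p, rfl⟩ := hr
      simp only [mul_smul]
      exact S.smul_mem _ (h _)
    | zero => simp
    | add _ _ _ _ h₁ h₂ => rw [add_smul]; exact S.add_mem h₁ h₂
    | neg _ _ h₁ => rw [neg_smul]; exact S.neg_mem h₁
  simpa using key 1 hfull

variable (hε)

/-- For y in Aε the element εy lies in the corner, so it crosses the tensor sign: εy ⊗ n = ε ⊗
(εy)n. The `ε`-part of Aε ⊗ N is thus no larger than `N`. -/
theorem smul_leftIdeal_tensor {N : Type*} [AddCommGroup N] [Module hε.Corner N]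
    (z : BimoduleTensor A hε.Corner hε.leftIdeal N) :
    ∃ n : N, ε • z = tmul A hε.Corner hε.leftUnit n := by
  induction z using BimoduleTensor.induction_on with
  | zero => exact ⟨0, (smul_zero _).trans (BimoduleTensor.tmul_zero _).symm⟩
  | tmul y n =>
    refine ⟨hε.cornerMul hε.rightUnit y • n, ?_⟩
    rw [← op_smul_tmul, smul_tmul']
    congr 1
    exact Subtype.ext (by
      change ε * y.1 = ε * (ε * y.1)
      rw [← mul_assoc, hε.eq])
  | add z z' h h' =>
    obtain ⟨n, h⟩ := h
    obtain ⟨n', h'⟩ := h'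
    exact ⟨n + n', by rw [smul_add, h, h', BimoduleTensor.tmul_add]⟩

section Comparison

variable {M : Type*} [AddCommGroup M] [Module A M] {N : Type*} [AddCommGroup N]
  [Module hε.Corner N] (g : N →+ M) (hg : ∀ (r : hε.Corner) n, g (r • n) = r.1 • g n)

/-- The map `Aε ⊗ N → M`, `y ⊗ n ↦ y g(n)`, for a map `g : N → M` compatible with the action of
`εAε`. -/
def leftTensorHom : BimoduleTensor A hε.Corner hε.leftIdeal N →ₗ[A] M :=
  lift
    { toFun := fun y =>
        ((DistribSMul.toAddMonoidHom M y.1).comp g).toIntLinearMap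
      map_add' := fun y z => LinearMap.ext fun n => add_smul y.1 z.1 (g n)
      map_smul' := fun r y => LinearMap.ext fun n => mul_smul r y.1 (g n) }
    (fun r y n => by
      change (y.1 * r.1) • g n = y.1 • g (r • n)
      rw [hg, mul_smul])

theorem leftTensorHom_tmul (y : hε.leftIdeal) (n : N) :
    hε.leftTensorHom g hg (tmul A hε.Corner y n) = y.1 • g n := rfl

variable {hε}

/-- The hypotheses say that g identifies `N` with εM. If z is in the kernel then so is every ε(yz) =
ε ⊗ n; its image is g n, so n = 0, and fullness gives z = 0. The range contains εM, hence is
everything, again by fullness. -/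
theorem IsFull.bijective_leftTensorHom (hfull : hε.IsFull) (hinj : Function.Injective g)
    (hrange : ∀ m : M, m ∈ Set.range g ↔ ε • m = m) :
    Function.Bijective (hε.leftTensorHom g hg) := by
  constructor
  · rw [injective_iff_map_eq_zero]
    intro z hz
    refine hfull.eq_zero fun y => ?_
    obtain ⟨n, hn⟩ := hε.smul_leftIdeal_tensor (y • z)
    rw [mul_smul, hn]
    have h1 := congrArg (hε.leftTensorHom g hg) hn
    rw [map_smul, map_smul, hz, smul_zero, smul_zero, leftTensorHom_tmul] at h1
    change 0 = ε • g n at h1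
    rw [(hrange (g n)).mp ⟨n, rfl⟩] at h1
    rw [(injective_iff_map_eq_zero g).mp hinj n h1.symm]
    simp [BimoduleTensor.tmul_zero]
  · intro m
    refine hfull.mem_submodule (LinearMap.range (hε.leftTensorHom g hg)) (fun m => ?_) m
    obtain ⟨n, hn⟩ := (hrange (ε • m)).mpr (by rw [← mul_smul, hε.eq])
    refine ⟨tmul A hε.Corner hε.leftUnit n, ?_⟩
    rw [leftTensorHom_tmul, hn]
    change ε • ε • m = ε • m
    rw [← mul_smul, hε.eq]

/-- A left `A`-module `M` is recovered from the `εAε`-module `εM` as `Aε ⊗ εM`, if `ε` is full. -/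
def IsFull.leftTensorEquiv (hfull : hε.IsFull) (hinj : Function.Injective g)
    (hrange : ∀ m : M, m ∈ Set.range g ↔ ε • m = m) :
    BimoduleTensor A hε.Corner hε.leftIdeal N ≃ₗ[A] M :=
  LinearEquiv.ofBijective _ (hfull.bijective_leftTensorHom g hg hinj hrange)

end Comparison

section Evaluation

variable (M : Type*) [AddCommGroup M] [Module A M]

/-- The subgroup `εM` of a left `A`-module `M`. -/
def cornerModule (_ : IsIdempotentElem ε) : AddSubgroup M where
  carrier := {m | ε • m = m}
  add_mem' {m n} hm hn := by
    change ε • (m + n) = m + n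
    rw [smul_add, show ε • m = m from hm, show ε • n = n from hn]
  zero_mem' := smul_zero ε
  neg_mem' {m} hm := by
    change ε • (-m) = -m
    rw [smul_neg, show ε • m = m from hm]

instance instModuleCornerModule : Module hε.Corner (hε.cornerModule M) where
  smul r m := ⟨r.1 • m.1, by
    change ε • r.1 • m.1 = r.1 • m.1
    rw [← mul_smul, ((Subsemigroup.mem_corner_iff hε).mp r.2).1]⟩
  one_smul m := Subtype.ext m.2
  mul_smul r r' m := Subtype.ext (mul_smul r.1 r'.1 m.1)
  smul_zero r := Subtype.ext (smul_zero r.1)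
  smul_add r m n := Subtype.ext (smul_add r.1 m.1 n.1)
  add_smul r r' m := Subtype.ext (add_smul r.1 r'.1 m.1)
  zero_smul m := Subtype.ext (zero_smul A m.1)

/-- The map `εA ⊗ M → εM`, `y ⊗ m ↦ y m`. -/
def rightTensorHom :
    BimoduleTensor hε.Corner A hε.rightIdeal M →ₗ[hε.Corner] hε.cornerModule M :=
  lift
    { toFun := fun y => AddMonoidHom.toIntLinearMap
        { toFun := fun m => (⟨y.1 • m, by
            change ε • y.1 • m = y.1 • m
            rw [← mul_smul, show ε * y.1 = y.1 from y.2]⟩ : hε.cornerModule M)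
          map_zero' := Subtype.ext (smul_zero y.1)
          map_add' := fun m n => Subtype.ext (smul_add y.1 m n) }
      map_add' := fun y z => LinearMap.ext fun m => Subtype.ext (add_smul y.1 z.1 m)
      map_smul' := fun r y => LinearMap.ext fun m => Subtype.ext (mul_smul r.1 y.1 m) }
    (fun r y m => Subtype.ext (mul_smul y.1 r m))

theorem rightTensorHom_tmul (y : hε.rightIdeal) (m : M) :
    (hε.rightTensorHom M (tmul hε.Corner A y m)).1 = y.1 • m := rfl

variable {M}

/-- Since y = εy, one has y ⊗ m = ε ⊗ ym. This identifies εA ⊗ M with εM for any idempotent, full or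
not. -/
theorem eq_rightUnit_tmul (z : BimoduleTensor hε.Corner A hε.rightIdeal M) :
    z = tmul hε.Corner A hε.rightUnit (hε.rightTensorHom M z).1 := by
  induction z using BimoduleTensor.induction_on with
  | zero => simp [BimoduleTensor.tmul_zero]
  | tmul y m =>
    rw [rightTensorHom_tmul, ← op_smul_tmul]
    congr 1
    exact Subtype.ext y.2.symm
  | add z z' h h' =>
    conv_lhs => rw [h, h']
    rw [map_add, AddSubgroup.coe_add, BimoduleTensor.tmul_add]

variable (M)

theorem bijective_rightTensorHom : Function.Bijective (hε.rightTensorHom M) := by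
  constructor
  · rw [injective_iff_map_eq_zero]
    intro z hz
    rw [hε.eq_rightUnit_tmul z, hz]
    simp [BimoduleTensor.tmul_zero]
  · intro m
    exact ⟨tmul hε.Corner A hε.rightUnit m.1, Subtype.ext m.2⟩

/-- The map `Aε ⊗ (εA ⊗ M) → M`, `y ⊗ (x ⊗ m) ↦ y x m`. -/
def leftRightTensorHom :
    BimoduleTensor A hε.Corner hε.leftIdeal (BimoduleTensor hε.Corner A hε.rightIdeal M)
      →ₗ[A] M :=
  hε.leftTensorHom ((hε.cornerModule M).subtype.comp (hε.rightTensorHom M).toAddMonoidHom)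
    fun r n => congrArg Subtype.val (map_smul (hε.rightTensorHom M) r n)

theorem leftRightTensorHom_tmul (y : hε.leftIdeal) (x : hε.rightIdeal) (m : M) :
    hε.leftRightTensorHom M (tmul A hε.Corner y (tmul hε.Corner A x m)) = y.1 • x.1 • m := rfl

-- This is the comparison above with N = εA ⊗ M, which has just been identified with εM.
variable {hε} in
theorem IsFull.bijective_leftRightTensorHom (hfull : hε.IsFull) :
    Function.Bijective (hε.leftRightTensorHom M) := by
  refine hfull.bijective_leftTensorHom _ _ ?_ ?_
  · exact Subtype.val_injective.comp (hε.bijective_rightTensorHom M).1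
  · intro m
    constructor
    · rintro ⟨z, rfl⟩
      exact (hε.rightTensorHom M z).2
    · intro hm
      obtain ⟨z, hz⟩ := (hε.bijective_rightTensorHom M).2 ⟨m, hm⟩
      exact ⟨z, congrArg Subtype.val hz⟩

end Evaluation

section Coevaluation

variable (N : Type*) [AddCommGroup N] [Module hε.Corner N]

/-- The map `Aε ⊗ N → N`, `y ⊗ n ↦ (x y) n`, for an element `x` of `εA`. -/
def contractLeft (x : hε.rightIdeal) : BimoduleTensor A hε.Corner hε.leftIdeal N →+ N :=
  liftAdd
    (AddMonoidHom.mk' (fun y => (DistribSMul.toAddMonoidHom N (hε.cornerMul x y)).toIntLinearMap)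
      fun y z => LinearMap.ext fun n => by
        change hε.cornerMul x (y + z) • n = hε.cornerMul x y • n + hε.cornerMul x z • n
        rw [← add_smul]
        congr 1
        exact Subtype.ext (mul_add x.1 y.1 z.1)).toIntLinearMap
    (fun r y n => by
      change hε.cornerMul x (MulOpposite.op r • y) • n = hε.cornerMul x y • r • n
      rw [← mul_smul]
      congr 1
      exact Subtype.ext (mul_assoc x.1 y.1 r.1).symm)

theorem contractLeft_tmul (x : hε.rightIdeal) (y : hε.leftIdeal) (n : N) :
    hε.contractLeft N x (tmul A hε.Corner y n) = hε.cornerMul x y • n := rfl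

/-- The map `εA ⊗ (Aε ⊗ N) → N`, `x ⊗ (y ⊗ n) ↦ (x y) n`. -/
def rightLeftTensorHom :
    BimoduleTensor hε.Corner A hε.rightIdeal (BimoduleTensor A hε.Corner hε.leftIdeal N)
      →ₗ[hε.Corner] N :=
  lift
    -- For fixed x the inner map goes from an `A`-module to a module over the corner only, so it is
    -- merely additive; corner-linearity appears in the variable x.
    { toFun := fun x => (hε.contractLeft N x).toIntLinearMap
      map_add' := fun x x' => LinearMap.ext fun z => by
        change hε.contractLeft N (x + x') z = hε.contractLeft N x z + hε.contractLeft N x' z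
        induction z using BimoduleTensor.induction_on with
        | zero => simp
        | tmul y n =>
          simp only [contractLeft_tmul, ← add_smul]
          congr 1
          exact Subtype.ext (add_mul x.1 x'.1 y.1)
        | add z z' h h' => simp only [map_add, h, h']; abel
      map_smul' := fun r x => LinearMap.ext fun z => by
        change hε.contractLeft N (r • x) z = r • hε.contractLeft N x z
        induction z using BimoduleTensor.induction_on with
        | zero => simp
        | tmul y n =>
          simp only [contractLeft_tmul, ← mul_smul]
          congr 1
          exact Subtype.ext (mul_assoc r.1 x.1 y.1)
        | add z z' h h' => simp only [map_add, h, h', smul_add] }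
    (fun r x z => by
      change hε.contractLeft N (MulOpposite.op r • x) z = hε.contractLeft N x (r • z)
      induction z using BimoduleTensor.induction_on with
      | zero => simp
      | tmul y n =>
        rw [smul_tmul', contractLeft_tmul, contractLeft_tmul]
        congr 1
        exact Subtype.ext (mul_assoc x.1 r y.1)
      | add z z' h h' => simp only [map_add, h, h', smul_add])

theorem rightLeftTensorHom_tmul (x : hε.rightIdeal) (y : hε.leftIdeal) (n : N) :
    hε.rightLeftTensorHom N (tmul hε.Corner A x (tmul A hε.Corner y n))
      = hε.cornerMul x y • n := rfl

theorem cornerMul_rightUnit_leftUnit : hε.cornerMul hε.rightUnit hε.leftUnit = 1 :=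
  Subtype.ext hε.eq

-- Both tensor signs can be crossed: x ⊗ (y ⊗ n) = ε ⊗ (xy ⊗ n), and xy = ε(xy) lies in the corner,
-- so this equals ε ⊗ (ε ⊗ (xy)n). Hence n ↦ ε ⊗ (ε ⊗ n) is the inverse of the contraction.
variable {N} in
theorem tmul_rightLeftTensorHom
    (z : BimoduleTensor hε.Corner A hε.rightIdeal (BimoduleTensor A hε.Corner hε.leftIdeal N)) :
    tmul hε.Corner A hε.rightUnit (tmul A hε.Corner hε.leftUnit (hε.rightLeftTensorHom N z))
      = z := by
  induction z using BimoduleTensor.induction_on with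
  | zero => simp [BimoduleTensor.tmul_zero]
  | tmul x z =>
    induction z using BimoduleTensor.induction_on with
    | zero => simp [BimoduleTensor.tmul_zero]
    | tmul y n =>
      have h₁ : MulOpposite.op (hε.cornerMul x y) • hε.leftUnit = x.1 • y :=
        Subtype.ext (by
          change ε * (x.1 * y.1) = x.1 * y.1
          rw [← mul_assoc, show ε * x.1 = x.1 from x.2])
      have h₂ : MulOpposite.op x.1 • hε.rightUnit = x := Subtype.ext x.2
      rw [rightLeftTensorHom_tmul, ← op_smul_tmul, h₁, ← smul_tmul', ← op_smul_tmul, h₂]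
    | add z z' h h' => simp only [BimoduleTensor.tmul_add, map_add, h, h']
  | add z z' h h' => simp only [BimoduleTensor.tmul_add, map_add, h, h']

theorem bijective_rightLeftTensorHom : Function.Bijective (hε.rightLeftTensorHom N) := by
  refine ⟨fun z z' h => ?_, fun n =>
    ⟨tmul hε.Corner A hε.rightUnit (tmul A hε.Corner hε.leftUnit n), ?_⟩⟩
  · rw [← hε.tmul_rightLeftTensorHom z, h, hε.tmul_rightLeftTensorHom]
  · rw [rightLeftTensorHom_tmul, cornerMul_rightUnit_leftUnit, one_smul]

end Coevaluation

section Equivalence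

theorem leftRightTensorHom_naturality {M N : Type*} [AddCommGroup M] [Module A M] [AddCommGroup N]
    [Module A N] (f : M →ₗ[A] N) (z) :
    hε.leftRightTensorHom N (BimoduleTensor.map _ _ _ (BimoduleTensor.map _ _ _ f) z)
      = f (hε.leftRightTensorHom M z) := by
  induction z using BimoduleTensor.induction_on with
  | zero => simp only [map_zero]
  | tmul y z =>
    induction z using BimoduleTensor.induction_on with
    | zero => simp only [BimoduleTensor.tmul_zero, map_zero]
    | tmul x m => simp only [map_tmul, leftRightTensorHom_tmul, map_smul]
    | add z z' h h' => simp only [BimoduleTensor.tmul_add, map_add, h, h']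
  | add z z' h h' => simp only [map_add, h, h']

theorem rightLeftTensorHom_naturality {M N : Type*} [AddCommGroup M] [Module hε.Corner M]
    [AddCommGroup N] [Module hε.Corner N] (f : M →ₗ[hε.Corner] N) (z) :
    hε.rightLeftTensorHom N (BimoduleTensor.map _ _ _ (BimoduleTensor.map _ _ _ f) z)
      = f (hε.rightLeftTensorHom M z) := by
  induction z using BimoduleTensor.induction_on with
  | zero => simp only [map_zero]
  | tmul y z =>
    induction z using BimoduleTensor.induction_on with
    | zero => simp only [BimoduleTensor.tmul_zero, map_zero]
    | tmul x m => simp only [map_tmul, rightLeftTensorHom_tmul, map_smul]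
    | add z z' h h' => simp only [BimoduleTensor.tmul_add, map_add, h, h']
  | add z z' h h' => simp only [map_add, h, h']

open CategoryTheory

variable {hε} in
/-- Tensoring with `εA` and with `Aε` are inverse equivalences between `A`-modules and
`εAε`-modules, for a full idempotent `ε`. -/
def IsFull.moduleEquivalence (hfull : hε.IsFull) :
    ModuleCat.{a} A ≌ ModuleCat.{a} hε.Corner :=
  CategoryTheory.Equivalence.mk
    (bimoduleTensorFunctor.{a, a, a, a} hε.Corner A hε.rightIdeal)
    (bimoduleTensorFunctor.{a, a, a, a} A hε.Corner hε.leftIdeal)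
    (NatIso.ofComponents
      (F := bimoduleTensorFunctor.{a, a, a, a} hε.Corner A hε.rightIdeal ⋙
        bimoduleTensorFunctor.{a, a, a, a} A hε.Corner hε.leftIdeal) (G := 𝟭 _)
      (fun M => (LinearEquiv.ofBijective _ (hfull.bijective_leftRightTensorHom M)).toModuleIso)
      (fun {_ _} f => ModuleCat.hom_ext (LinearMap.ext fun z =>
        hε.leftRightTensorHom_naturality f.hom z))).symm
    (NatIso.ofComponents
      (F := bimoduleTensorFunctor.{a, a, a, a} A hε.Corner hε.leftIdeal ⋙
        bimoduleTensorFunctor.{a, a, a, a} hε.Corner A hε.rightIdeal) (G := 𝟭 _)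
      (fun N => (LinearEquiv.ofBijective _ (hε.bijective_rightLeftTensorHom N)).toModuleIso)
      (fun {_ _} f => ModuleCat.hom_ext (LinearMap.ext fun z =>
        hε.rightLeftTensorHom_naturality f.hom z)))

open scoped ModuleCat.Algebra

/-- Scalars of `K` act on modules through the two algebra maps. A scalar r on m crosses to x as
right multiplication; being central in `A`, it agrees there with left multiplication by rε, the
image of r in the corner. -/
theorem linear_bimoduleTensorFunctor (K : Type k) [Field K] [Algebra K A] :
    Functor.Linear K (bimoduleTensorFunctor.{a, a, a, a} hε.Corner A hε.rightIdeal) where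
  map_smul {M N} f r := ModuleCat.hom_ext (LinearMap.ext fun z => by
    change BimoduleTensor.map _ _ _ (r • f).hom z
      = algebraMap K hε.Corner r • BimoduleTensor.map _ _ _ f.hom z
    induction z using BimoduleTensor.induction_on with
    | zero => simp
    | tmul x m =>
      rw [map_tmul, map_tmul, smul_tmul']
      change tmul hε.Corner A x (algebraMap K A r • f.hom m) = _
      rw [← op_smul_tmul]
      congr 1
      exact Subtype.ext (by
        change x.1 * algebraMap K A r = (r • ε) * x.1
        rw [← Algebra.commutes, smul_mul_assoc, show ε * x.1 = x.1 from x.2, Algebra.smul_def])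
    | add z z' h h' => simp only [map_add, h, h', smul_add])

variable {hε} in
/-- The Morita equivalence between `A` and an algebra isomorphic to `εAε`, for a full idempotent
`ε`. -/
def IsFull.moritaEquivalence (hfull : hε.IsFull) (K : Type k) [Field K] [Algebra K A]
    {B : Type a} [Ring B] [Algebra K B] (φ : B ≃ₐ[K] hε.Corner) : MoritaEquivalence K A B where
  eqv := hfull.moduleEquivalence.trans
    (ModuleCat.restrictScalarsEquivalenceOfRingEquiv φ.toRingEquiv)
  linear := by
    have h₁ : Functor.Linear K hfull.moduleEquivalence.functor :=
      hε.linear_bimoduleTensorFunctor K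
    have h₂ := ModuleCat.Algebra.restrictScalarsEquivalenceOfRingEquiv_linear φ
    exact Functor.instLinearComp _ _

end Equivalence

end IsIdempotentElem

namespace IsIdempotentElem

variable {A : Type a} [Ring A] {ε : A} (hε : IsIdempotentElem ε)

/-- An element `y` with `ε y = y = y ε`, as an element of the corner ring. -/
def toCorner (y : A) (h : ε * y = y) (h' : y * ε = y) : hε.Corner :=
  ⟨y, (Subsemigroup.mem_corner_iff hε).mpr ⟨h, h'⟩⟩

theorem coe_sum_corner {ι : Type*} (s : Finset ι) (f : ι → hε.Corner) :
    (∑ i ∈ s, f i).1 = ∑ i ∈ s, (f i).1 :=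
  map_sum (AddMonoidHom.mk' (fun y : hε.Corner => y.1) fun _ _ => rfl) f s

end IsIdempotentElem

/-! ### The defining relations and the universal property in usable form. -/

namespace DirGraph

section Relations

variable (K : Type k) [Field K] {V : Type u} {X : Type w} (E : DirGraph V X)

theorem source_mul_edge (e : X) : E.vertex K (E.s e) * E.edge K e = E.edge K e := by
  have h := RingQuot.mkAlgHom_rel K (LeavittRel.source_edge (K := K) (E := E) e)
  rwa [map_mul] at h

theorem edge_mul_range (e : X) : E.edge K e * E.vertex K (E.r e) = E.edge K e := by
  have h := RingQuot.mkAlgHom_rel K (LeavittRel.edge_range (K := K) (E := E) e)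
  rwa [map_mul] at h

theorem range_mul_ghost (e : X) : E.vertex K (E.r e) * E.ghost K e = E.ghost K e := by
  have h := RingQuot.mkAlgHom_rel K (LeavittRel.range_ghost (K := K) (E := E) e)
  rwa [map_mul] at h

theorem ghost_mul_source (e : X) : E.ghost K e * E.vertex K (E.s e) = E.ghost K e := by
  have h := RingQuot.mkAlgHom_rel K (LeavittRel.ghost_source (K := K) (E := E) e)
  rwa [map_mul] at h

theorem ghost_mul_edge_self (e : X) : E.ghost K e * E.edge K e = E.vertex K (E.r e) := by
  have h := RingQuot.mkAlgHom_rel K (LeavittRel.ghost_edge_self (K := K) (E := E) e)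
  rwa [map_mul] at h

theorem ghost_mul_edge_of_ne {e f : X} (hef : e ≠ f) : E.ghost K e * E.edge K f = 0 := by
  have h := RingQuot.mkAlgHom_rel K (LeavittRel.ghost_edge_ne (K := K) (E := E) e f hef)
  rwa [map_mul, map_zero] at h

theorem sum_vertex [Fintype V] : ∑ v, E.vertex K v = 1 := by
  have h := RingQuot.mkAlgHom_rel K (LeavittRel.sum_vertex (K := K) (E := E))
  rwa [finsum_eq_sum_of_fintype, map_sum, map_one] at h

theorem vertex_eq_finsum [Finite X] {v : V} (hv : ¬ E.IsSink v) :
    E.vertex K v = ∑ᶠ e : {e : X // E.s e = v}, E.edge K e.1 * E.ghost K e.1 := by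
  have := Fintype.ofFinite {e : X // E.s e = v}
  have h := RingQuot.mkAlgHom_rel K (LeavittRel.sum_edge_ghost (K := K) (E := E) v hv)
  rw [finsum_eq_sum_of_fintype, map_sum] at h
  simp only [map_mul] at h
  rw [finsum_eq_sum_of_fintype]
  exact h

theorem vertex_mul_ghost_of_ne {v : V} {e : X} (h : v ≠ E.r e) :
    E.vertex K v * E.ghost K e = 0 := by
  rw [← range_mul_ghost, ← mul_assoc, vertex_mul_of_ne K E h, zero_mul]

theorem ghost_mul_vertex_of_ne {v : V} {e : X} (h : E.s e ≠ v) :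
    E.ghost K e * E.vertex K v = 0 := by
  rw [← ghost_mul_source, mul_assoc, vertex_mul_of_ne K E h, mul_zero]

theorem ghost_mul_edge_of_source_ne {e f : X} (h : E.s e ≠ E.s f) :
    E.ghost K e * E.edge K f = 0 :=
  ghost_mul_edge_of_ne K E fun h' => h (congrArg E.s h')

theorem ghost_mul_ghost_of_ne {e f : X} (h : E.s e ≠ E.r f) :
    E.ghost K e * E.ghost K f = 0 := by
  rw [← ghost_mul_source, mul_assoc, vertex_mul_ghost_of_ne K E h, mul_zero]

variable {K E}

/-- Induction principle for the elements of a Leavitt path algebra. -/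
theorem LPA.induction {motive : E.LPA K → Prop} (algebraMap : ∀ r, motive (algebraMap K _ r))
    (vertex : ∀ v, motive (E.vertex K v)) (edge : ∀ e, motive (E.edge K e))
    (ghost : ∀ e, motive (E.ghost K e)) (mul : ∀ y z, motive y → motive z → motive (y * z))
    (add : ∀ y z, motive y → motive z → motive (y + z)) (y : E.LPA K) : motive y := by
  obtain ⟨y, rfl⟩ := RingQuot.mkAlgHom_surjective K (E.LeavittRel K) y
  induction y using FreeAlgebra.induction with
  | grade0 r => rw [AlgHom.commutes]; exact algebraMap r
  | grade1 g =>
    cases g with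
    | vertex v => exact vertex v
    | edge e => exact edge e
    | ghost e => exact ghost e
  | mul y z hy hz => rw [map_mul]; exact mul _ _ hy hz
  | add y z hy hz => rw [map_add]; exact add _ _ hy hz

section Lift

variable {A : Type*} [Ring A] [Algebra K A] (P : V → A) (S T : X → A)
    (h₁ : ∑ᶠ v, P v = 1) (h₂ : ∀ v, P v * P v = P v) (h₃ : ∀ v v', v ≠ v' → P v * P v' = 0)
    (h₄ : ∀ e, P (E.s e) * S e = S e) (h₅ : ∀ e, S e * P (E.r e) = S e)
    (h₆ : ∀ e, P (E.r e) * T e = T e) (h₇ : ∀ e, T e * P (E.s e) = T e)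
    (h₈ : ∀ e, T e * S e = P (E.r e)) (h₉ : ∀ e f, e ≠ f → T e * S f = 0)
    (h₁₀ : ∀ v, ¬ E.IsSink v → P v = ∑ᶠ e : {e : X // E.s e = v}, S e.1 * T e.1)
    [Finite V] [Finite X]

theorem liftLPA_vertex (v : V) :
    liftLPA P S T h₁ h₂ h₃ h₄ h₅ h₆ h₇ h₈ h₉ h₁₀ (E.vertex K v) = P v := by
  unfold liftLPA vertex gen
  erw [RingQuot.liftAlgHom_mkAlgHom_apply]
  simp [freeGen]

theorem liftLPA_edge (e : X) :
    liftLPA P S T h₁ h₂ h₃ h₄ h₅ h₆ h₇ h₈ h₉ h₁₀ (E.edge K e) = S e := by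
  unfold liftLPA edge gen
  erw [RingQuot.liftAlgHom_mkAlgHom_apply]
  simp [freeGen]

theorem liftLPA_ghost (e : X) :
    liftLPA P S T h₁ h₂ h₃ h₄ h₅ h₆ h₇ h₈ h₉ h₁₀ (E.ghost K e) = T e := by
  unfold liftLPA ghost gen
  erw [RingQuot.liftAlgHom_mkAlgHom_apply]
  simp [freeGen]

end Lift

end Relations

/-! ### Products of `ε` with the generators. -/

section VertexSum

variable (K : Type k) [Field K] {V : Type u} {X : Type w} (E : DirGraph V X) [Finite V]
  {H : Set V}

theorem vertexSum_mul_vertex {v : V} (hv : v ∈ H) :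
    E.vertexSum K H * E.vertex K v = E.vertex K v := by
  classical
  have := Fintype.ofFinite H
  unfold vertexSum
  rw [finsum_eq_sum_of_fintype, Finset.sum_mul, Finset.sum_eq_single ⟨v, hv⟩]
  · exact vertex_mul_self K E v
  · intro v' _ hne
    exact vertex_mul_of_ne K E fun h => hne (Subtype.ext h)
  · simp

theorem vertex_mul_vertexSum {v : V} (hv : v ∈ H) :
    E.vertex K v * E.vertexSum K H = E.vertex K v := by
  classical
  have := Fintype.ofFinite H
  unfold vertexSum
  rw [finsum_eq_sum_of_fintype, Finset.mul_sum, Finset.sum_eq_single ⟨v, hv⟩]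
  · exact vertex_mul_self K E v
  · intro v' _ hne
    exact vertex_mul_of_ne K E fun h => hne (Subtype.ext h.symm)
  · simp

theorem vertexSum_mul_vertex_of_notMem {v : V} (hv : v ∉ H) :
    E.vertexSum K H * E.vertex K v = 0 := by
  have := Fintype.ofFinite H
  unfold vertexSum
  rw [finsum_eq_sum_of_fintype, Finset.sum_mul]
  exact Finset.sum_eq_zero fun v' _ => vertex_mul_of_ne K E fun h => hv (h ▸ v'.2)

theorem vertex_mul_vertexSum_of_notMem {v : V} (hv : v ∉ H) :
    E.vertex K v * E.vertexSum K H = 0 := by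
  have := Fintype.ofFinite H
  unfold vertexSum
  rw [finsum_eq_sum_of_fintype, Finset.mul_sum]
  exact Finset.sum_eq_zero fun v' _ => vertex_mul_of_ne K E fun h => hv (h ▸ v'.2)

theorem vertexSum_mul_edge {e : X} (he : E.s e ∈ H) :
    E.vertexSum K H * E.edge K e = E.edge K e := by
  rw [← source_mul_edge, ← mul_assoc, vertexSum_mul_vertex K E he]

theorem vertexSum_mul_edge_of_notMem {e : X} (he : E.s e ∉ H) :
    E.vertexSum K H * E.edge K e = 0 := by
  rw [← source_mul_edge, ← mul_assoc, vertexSum_mul_vertex_of_notMem K E he, zero_mul]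

theorem edge_mul_vertexSum {e : X} (he : E.r e ∈ H) :
    E.edge K e * E.vertexSum K H = E.edge K e := by
  rw [← edge_mul_range, mul_assoc, vertex_mul_vertexSum K E he]

theorem vertexSum_mul_ghost {e : X} (he : E.r e ∈ H) :
    E.vertexSum K H * E.ghost K e = E.ghost K e := by
  rw [← range_mul_ghost, ← mul_assoc, vertexSum_mul_vertex K E he]

theorem ghost_mul_vertexSum {e : X} (he : E.s e ∈ H) :
    E.ghost K e * E.vertexSum K H = E.ghost K e := by
  rw [← ghost_mul_source, mul_assoc, vertex_mul_vertexSum K E he]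

theorem ghost_mul_vertexSum_of_notMem {e : X} (he : E.s e ∉ H) :
    E.ghost K e * E.vertexSum K H = 0 := by
  rw [← ghost_mul_source, mul_assoc, vertex_mul_vertexSum_of_notMem K E he, mul_zero]

theorem vertexSum_compl_singleton (v : V) :
    E.vertexSum K ({v}ᶜ : Set V) + E.vertex K v = 1 := by
  classical
  have := Fintype.ofFinite V
  rw [← sum_vertex K E, ← Finset.sum_erase_add _ _ (Finset.mem_univ v)]
  congr 1
  unfold vertexSum
  rw [finsum_eq_sum_of_fintype]
  exact (Finset.sum_subtype _ (by simp) _).symm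

end VertexSum

/-! ### The homomorphism from L_K(E_H) to the corner. -/

section Restrict

variable {V : Type u} {X : Type w} {E : DirGraph V X} {H : Set V} (hH : E.IsHereditary H)

/-- The edges of `E_H` leaving a vertex of `H` are the edges of `E` leaving it. -/
def restrictEdgesEquiv (v : H) :
    {e : {e : X // E.s e ∈ H} // (E.restrict H hH).s e = v} ≃ {e : X // E.s e = v.1} where
  toFun e := ⟨e.1.1, congrArg Subtype.val e.2⟩
  invFun e := ⟨⟨e.1, Set.mem_of_eq_of_mem e.2 v.2⟩, Subtype.ext e.2⟩
  left_inv _ := rfl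
  right_inv _ := rfl

theorem restrict_isSink_iff {v : H} : (E.restrict H hH).IsSink v ↔ E.IsSink v.1 :=
  ⟨fun h e he => h ⟨e, he ▸ v.2⟩ (Subtype.ext he), fun h e he => h e.1 (congrArg Subtype.val he)⟩

variable (K : Type k) [Field K] [Finite V] [Finite X]

/-- The homomorphism `L_K(E_H) → ε L_K(E) ε`, for a hereditary set `H` and `ε = ∑_{v ∈ H} v`. -/
def restrictHom :
    (E.restrict H hH).LPA K →ₐ[K] (E.isIdempotentElem_vertexSum K H).Corner :=
  liftLPA
    (fun v => (E.isIdempotentElem_vertexSum K H).toCorner (E.vertex K v.1)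
      (vertexSum_mul_vertex K E v.2) (vertex_mul_vertexSum K E v.2))
    (fun e => (E.isIdempotentElem_vertexSum K H).toCorner (E.edge K e.1)
      (vertexSum_mul_edge K E e.2) (edge_mul_vertexSum K E (hH.r_mem e.2)))
    (fun e => (E.isIdempotentElem_vertexSum K H).toCorner (E.ghost K e.1)
      (vertexSum_mul_ghost K E (hH.r_mem e.2)) (ghost_mul_vertexSum K E e.2))
    (by
      have := Fintype.ofFinite H
      rw [finsum_eq_sum_of_fintype]
      refine Subtype.ext (((E.isIdempotentElem_vertexSum K H).coe_sum_corner _ _).trans ?_)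
      -- The unit of the corner is `ε`, by definition the sum of the vertices in `H`.
      exact (finsum_eq_sum_of_fintype _).symm)
    (fun v => Subtype.ext (vertex_mul_self K E v.1))
    (fun v v' h => Subtype.ext (vertex_mul_of_ne K E fun h' => h (Subtype.ext h')))
    (fun e => Subtype.ext (source_mul_edge K E e.1))
    (fun e => Subtype.ext (edge_mul_range K E e.1))
    (fun e => Subtype.ext (range_mul_ghost K E e.1))
    (fun e => Subtype.ext (ghost_mul_source K E e.1))
    (fun e => Subtype.ext (ghost_mul_edge_self K E e.1))
    (fun e f h => Subtype.ext (ghost_mul_edge_of_ne K E fun h' => h (Subtype.ext h')))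
    (fun v h => by
      have := Fintype.ofFinite {e : {e : X // E.s e ∈ H} // (E.restrict H hH).s e = v}
      rw [restrict_isSink_iff] at h
      rw [finsum_eq_sum_of_fintype]
      refine Subtype.ext ?_
      refine (vertex_eq_finsum K E h).trans
        (Eq.trans ?_ ((E.isIdempotentElem_vertexSum K H).coe_sum_corner _ _).symm)
      -- A vertex of `H` keeps all its outgoing edges in E_H, so its relation in E is term by term
      -- the one needed here.
      rw [← finsum_comp_equiv (restrictEdgesEquiv hH v), finsum_eq_sum_of_fintype]
      rfl)

theorem restrictHom_vertex (v : H) :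
    (restrictHom hH K ((E.restrict H hH).vertex K v)).1 = E.vertex K v.1 :=
  congrArg (fun y : (E.isIdempotentElem_vertexSum K H).Corner => y.1) (liftLPA_vertex ..)

theorem restrictHom_edge (e : {e : X // E.s e ∈ H}) :
    (restrictHom hH K ((E.restrict H hH).edge K e)).1 = E.edge K e.1 :=
  congrArg (fun y : (E.isIdempotentElem_vertexSum K H).Corner => y.1) (liftLPA_edge ..)

theorem restrictHom_ghost (e : {e : X // E.s e ∈ H}) :
    (restrictHom hH K ((E.restrict H hH).ghost K e)).1 = E.ghost K e.1 :=
  congrArg (fun y : (E.isIdempotentElem_vertexSum K H).Corner => y.1) (liftLPA_ghost ..)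

end Restrict

end DirGraph

/-! ### Removing a source vertex: fullness of `ε` and generators of the corner. -/

namespace DirGraph

variable {V : Type u} {X : Type w} {E : DirGraph V X} {u₀ : V} (hu₀ : E.IsSource u₀)
  (K : Type k) [Field K] 

/-- The idempotent `∑_{v ≠ u₀} v` of `L_K(E)` is full if the source vertex `u₀` is not isolated. -/
theorem IsSource.isFull_vertexSum [Finite V] [Finite X] (hu₀ : E.IsSource u₀) (hns : ¬ E.IsSink u₀) :
    (E.isIdempotentElem_vertexSum K ({u₀}ᶜ : Set V)).IsFull := by
  unfold IsIdempotentElem.IsFull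
  rw [← vertexSum_compl_singleton K E u₀]
  refine add_mem (AddSubgroup.subset_closure ⟨(1, 1), by simp⟩) ?_
  have := Fintype.ofFinite {e : X // E.s e = u₀}
  rw [vertex_eq_finsum K E hns, finsum_eq_sum_of_fintype]
  -- As r(e) ≠ u₀, one has e ε = e, so that e e* = e ε e*.
  refine sum_mem fun e _ => AddSubgroup.subset_closure ⟨(E.edge K e.1, E.ghost K e.1), ?_⟩
  change E.edge K e.1 * E.vertexSum K _ * E.ghost K e.1 = _
  rw [edge_mul_vertexSum K E (hu₀ e.1)]

/-- The condition `S` below is stable under left multiplication by all of `A` and holds for `ε`,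
hence for every yε. Its first half then puts εyε in the image. -/
theorem IsSource.surjective_restrictHom [Finite V] [Finite X] :
    Function.Surjective (restrictHom hu₀.isHereditary_compl K) := by
  set H : Set V := {u₀}ᶜ with hH
  set hε := E.isIdempotentElem_vertexSum K H
  -- The image viewed inside `A`; its unit is `ε` and not 1.
  let D : NonUnitalSubring (E.LPA K) :=
    { carrier := Set.range fun y => (restrictHom hu₀.isHereditary_compl K y).1
      zero_mem' := ⟨0, congrArg (fun y : hε.Corner => y.1) (map_zero _)⟩
      add_mem' := by rintro _ _ ⟨y, rfl⟩ ⟨z, rfl⟩; exact ⟨y + z, by simp only [map_add]; rfl⟩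
      neg_mem' := by rintro _ ⟨y, rfl⟩; exact ⟨-y, by simp only [map_neg]; rfl⟩
      mul_mem' := by rintro _ _ ⟨y, rfl⟩ ⟨z, rfl⟩; exact ⟨y * z, by simp only [map_mul]; rfl⟩ }
  have smul_mem : ∀ (r : K) {y}, y ∈ D → r • y ∈ D := by
    rintro r _ ⟨y, rfl⟩
    exact ⟨r • y, by simp only [map_smul]; rfl⟩
  have vertex_mem : ∀ {v}, v ∈ H → E.vertex K v ∈ D := fun {v} hv =>
    ⟨_, restrictHom_vertex hu₀.isHereditary_compl K ⟨v, hv⟩⟩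
  have edge_mem : ∀ {e}, E.s e ∈ H → E.edge K e ∈ D := fun {e} he =>
    ⟨_, restrictHom_edge hu₀.isHereditary_compl K ⟨e, he⟩⟩
  have ghost_mem : ∀ {e}, E.s e ∈ H → E.ghost K e ∈ D := fun {e} he =>
    ⟨_, restrictHom_ghost hu₀.isHereditary_compl K ⟨e, he⟩⟩
  have one_mem : E.vertexSum K H ∈ D := ⟨1, congrArg (fun y : hε.Corner => y.1) (map_one _)⟩
  have mem_or : ∀ v, v ∈ H ∨ v = u₀ := fun v => (em (v = u₀)).symm
  have notMem : ∀ {v}, v = u₀ → v ∉ H := fun h h' => h' h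
  -- The first clause alone is not stable: for a ghost f* with s(f) = u₀ one has ε f* z = f* z,
  -- about which εz says nothing. The second clause records exactly these elements.
  let S : E.LPA K → Prop := fun y =>
    E.vertexSum K H * y ∈ D ∧ ∀ e, E.s e = u₀ → E.ghost K e * y ∈ D
  have key : ∀ y z, S z → S (y * z) := by
    intro y
    induction y using LPA.induction with
    | algebraMap r =>
      intro z hz
      rw [← Algebra.smul_def]
      exact ⟨by rw [mul_smul_comm]; exact smul_mem r hz.1,
        fun e he => by rw [mul_smul_comm]; exact smul_mem r (hz.2 e he)⟩
    | vertex v =>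
      intro z hz
      rcases mem_or v with hv | rfl
      · refine ⟨?_, fun e he => ?_⟩
        · rw [← mul_assoc, vertexSum_mul_vertex K E hv, ← vertex_mul_vertexSum K E hv, mul_assoc]
          exact D.mul_mem (vertex_mem hv) hz.1
        · rw [← mul_assoc, ghost_mul_vertex_of_ne K E fun h => notMem he (h ▸ hv), zero_mul]
          exact D.zero_mem
      · refine ⟨?_, fun e he => ?_⟩
        · rw [← mul_assoc, vertexSum_mul_vertex_of_notMem K E (notMem rfl), zero_mul]
          exact D.zero_mem
        · rw [← mul_assoc, ← he, ghost_mul_source]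
          exact hz.2 e he
    | edge f =>
      intro z hz
      have hr : E.r f ∈ H := hu₀ f
      rcases mem_or (E.s f) with hf | hf
      · refine ⟨?_, fun e he => ?_⟩
        · rw [← mul_assoc, vertexSum_mul_edge K E hf, ← edge_mul_vertexSum K E hr, mul_assoc]
          exact D.mul_mem (edge_mem hf) hz.1
        · rw [← mul_assoc, ghost_mul_edge_of_source_ne K E fun h => notMem he (h.symm ▸ hf), zero_mul]
          exact D.zero_mem
      · refine ⟨?_, fun e he => ?_⟩
        · rw [← mul_assoc, vertexSum_mul_edge_of_notMem K E (notMem hf), zero_mul]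
          exact D.zero_mem
        · rw [← mul_assoc]
          by_cases hef : e = f
          · rw [hef, ghost_mul_edge_self, ← vertex_mul_vertexSum K E hr, mul_assoc]
            exact D.mul_mem (vertex_mem hr) hz.1
          · rw [ghost_mul_edge_of_ne K E hef, zero_mul]
            exact D.zero_mem
    | ghost f =>
      intro z hz
      refine ⟨?_, fun e he => ?_⟩
      · rw [← mul_assoc, vertexSum_mul_ghost K E (hu₀ f)]
        rcases mem_or (E.s f) with hf | hf
        · rw [← ghost_mul_vertexSum K E hf, mul_assoc]
          exact D.mul_mem (ghost_mem hf) hz.1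
        · exact hz.2 f hf
      -- Here e* f* = 0, since s(e) = u₀ is not the range of f.
      · rw [← mul_assoc, ghost_mul_ghost_of_ne K E fun h => hu₀ f (h ▸ he), zero_mul]
        exact D.zero_mem
    | mul y y' hy hy' => intro z hz; rw [mul_assoc]; exact hy _ (hy' _ hz)
    | add y y' hy hy' =>
      intro z hz
      rw [add_mul]
      refine ⟨?_, fun e he => ?_⟩
      · rw [mul_add]; exact D.add_mem (hy z hz).1 (hy' z hz).1
      · rw [mul_add]; exact D.add_mem ((hy z hz).2 e he) ((hy' z hz).2 e he)
  have base : S (E.vertexSum K H) :=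
    ⟨by rw [hε.eq]; exact one_mem, fun e he => by
      rw [ghost_mul_vertexSum_of_notMem K E (notMem he)]; exact D.zero_mem⟩
  intro y
  have hy := (Subsemigroup.mem_corner_iff hε).mp y.2
  obtain ⟨z, hz⟩ := (key y.1 _ base).1
  refine ⟨z, Subtype.ext (hz.trans ?_)⟩
  rw [← mul_assoc, hy.1, hy.2]

/-! ### A representation of L_K(E) that proves injectivity. -/

namespace IsSource

/-- The restriction of `E` to the complement of the source vertex `u₀`. -/
abbrev compl : DirGraph ({u₀}ᶜ : Set V) {e : X // E.s e ∈ ({u₀}ᶜ : Set V)} :=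
  E.restrict _ hu₀.isHereditary_compl

/-- The space `v L_K(E_H)`, where `v = r(e)`, for an edge `e`. -/
abbrev rangePart (e : X) : Submodule K (hu₀.compl.LPA K) :=
  LinearMap.range (LinearMap.mulLeft K (hu₀.compl.vertex K ⟨E.r e, hu₀ e⟩))

/-- This is why the summands are cut down to r(e) L_K(E_H): the relations r(e) e* = e* and u₀ = ∑ e
e* both need r(e) to act as the identity there. -/
theorem vertex_mul_rangePart {e : X} (y : hu₀.rangePart K e) :
    hu₀.compl.vertex K ⟨E.r e, hu₀ e⟩ * y.1 = y.1 := by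
  obtain ⟨_, z, rfl⟩ := y
  change _ * (_ * z) = _ * z
  rw [← mul_assoc, vertex_mul_self]

/-- The space `L_K(E_H) ⊕ ⨁_{s(e) = u₀} r(e) L_K(E_H)` on which `L_K(E)` acts. -/
abbrev Space : Type _ :=
  -- Modelled on Aε = εAε ⊕ u₀Aε: since u₀ = ∑ e e*, the second part is the sum of the spaces e ·
  -- r(e)εAε, and the factor at e stands for the coefficient of e.
  hu₀.compl.LPA K × (∀ e : {e : X // E.s e = u₀}, hu₀.rangePart K e.1)

open scoped Classical in
/-- The action of a vertex on `L_K(E_H) ⊕ ⨁_{s(e) = u₀} r(e) L_K(E_H)`. -/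
def vertexOp (v : V) : Module.End K (hu₀.Space K) :=
  if h : v = u₀ then LinearMap.inr K _ _ ∘ₗ LinearMap.snd K _ _
  else LinearMap.inl K _ _ ∘ₗ LinearMap.mulLeft K (hu₀.compl.vertex K ⟨v, h⟩) ∘ₗ
    LinearMap.fst K _ _

open scoped Classical in
/-- The action of an edge on `L_K(E_H) ⊕ ⨁_{s(e) = u₀} r(e) L_K(E_H)`. -/
def edgeOp (e : X) : Module.End K (hu₀.Space K) :=
  if h : E.s e = u₀ then
    LinearMap.inr K _ _ ∘ₗ
      LinearMap.single K (fun e : {e : X // E.s e = u₀} => hu₀.rangePart K e.1) ⟨e, h⟩ ∘ₗ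
      LinearMap.rangeRestrict _ ∘ₗ LinearMap.fst K _ _
  else LinearMap.inl K _ _ ∘ₗ LinearMap.mulLeft K (hu₀.compl.edge K ⟨e, h⟩) ∘ₗ
    LinearMap.fst K _ _

open scoped Classical in
/-- The action of a ghost edge on `L_K(E_H) ⊕ ⨁_{s(e) = u₀} r(e) L_K(E_H)`. -/
def ghostOp (e : X) : Module.End K (hu₀.Space K) :=
  if h : E.s e = u₀ then
    LinearMap.inl K _ _ ∘ₗ Submodule.subtype _ ∘ₗ
      LinearMap.proj (φ := fun e : {e : X // E.s e = u₀} => hu₀.rangePart K e.1) ⟨e, h⟩ ∘ₗ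
      LinearMap.snd K _ _
  else LinearMap.inl K _ _ ∘ₗ LinearMap.mulLeft K (hu₀.compl.ghost K ⟨e, h⟩) ∘ₗ
    LinearMap.fst K _ _

section Operators

variable (z : hu₀.Space K)

theorem vertexOp_self : hu₀.vertexOp K u₀ z = (0, z.2) := by
  simp [vertexOp]

theorem vertexOp_of_ne {v : V} (h : v ≠ u₀) :
    hu₀.vertexOp K v z = (hu₀.compl.vertex K ⟨v, h⟩ * z.1, 0) := by
  simp [vertexOp, h]

open scoped Classical in
theorem edgeOp_of_eq {e : X} (h : E.s e = u₀) :
    hu₀.edgeOp K e z = (0, Pi.single (M := fun e : {e : X // E.s e = u₀} => hu₀.rangePart K e.1)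
      ⟨e, h⟩ ⟨hu₀.compl.vertex K ⟨E.r e, hu₀ e⟩ * z.1, z.1, rfl⟩) := by
  simp [edgeOp, h]
  rfl

theorem edgeOp_of_ne {e : X} (h : E.s e ≠ u₀) :
    hu₀.edgeOp K e z = (hu₀.compl.edge K ⟨e, h⟩ * z.1, 0) := by
  simp [edgeOp, h]

theorem ghostOp_of_eq {e : X} (h : E.s e = u₀) :
    hu₀.ghostOp K e z = ((z.2 ⟨e, h⟩).1, 0) := by
  simp [ghostOp, h]

theorem ghostOp_of_ne {e : X} (h : E.s e ≠ u₀) :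
    hu₀.ghostOp K e z = (hu₀.compl.ghost K ⟨e, h⟩ * z.1, 0) := by
  simp [ghostOp, h]

end Operators

variable [Finite V] [Finite X]

/-- The representation of `L_K(E)` on `L_K(E_H) ⊕ ⨁_{s(e) = u₀} r(e) L_K(E_H)`. -/
def spaceHom : E.LPA K →ₐ[K] Module.End K (hu₀.Space K) :=
  liftLPA (hu₀.vertexOp K) (hu₀.edgeOp K) (hu₀.ghostOp K)
    (by
      classical
      have := Fintype.ofFinite V
      have inst := Fintype.ofFinite ({u₀}ᶜ : Set V)
      rw [finsum_eq_sum_of_fintype, ← Finset.sum_erase_add _ _ (Finset.mem_univ u₀)]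
      refine LinearMap.ext fun z => ?_
      rw [LinearMap.add_apply, vertexOp_self, LinearMap.sum_apply,
        Finset.sum_subtype (F := inst) (p := fun v => v ∈ ({u₀}ᶜ : Set V)) _ (by simp)]
      have h : ∀ v : ({u₀}ᶜ : Set V), hu₀.vertexOp K v.1 z = (hu₀.compl.vertex K v * z.1, 0) :=
        fun v => hu₀.vertexOp_of_ne K z v.2
      simp only [h]
      refine Prod.ext ?_ ?_
      · rw [Prod.fst_add, Prod.fst_sum, ← Finset.sum_mul, sum_vertex]
        simp
      · rw [Prod.snd_add, Prod.snd_sum]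
        simp)
    (fun v => LinearMap.ext fun z => by
      rw [Module.End.mul_apply]
      by_cases h : v = u₀
      · subst h
        simp only [vertexOp_self]
      · simp only [vertexOp_of_ne _ _ _ h, ← mul_assoc, vertex_mul_self])
    (fun v v' hv => LinearMap.ext fun z => by
      rw [Module.End.mul_apply]
      by_cases h : v = u₀
      · subst h
        rw [vertexOp_of_ne _ _ _ (Ne.symm hv), vertexOp_self]
        rfl
      · by_cases h' : v' = u₀
        · subst h'
          rw [vertexOp_self, vertexOp_of_ne _ _ _ h]
          simp
        · rw [vertexOp_of_ne _ _ _ h, vertexOp_of_ne _ _ _ h', ← mul_assoc,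
            vertex_mul_of_ne _ _ fun h => hv (congrArg Subtype.val h), zero_mul]
          rfl)
    (fun e => LinearMap.ext fun z => by
      rw [Module.End.mul_apply]
      by_cases h : E.s e = u₀
      · rw [edgeOp_of_eq _ _ _ h, h, vertexOp_self]
      · rw [edgeOp_of_ne _ _ _ h, vertexOp_of_ne _ _ _ h, ← mul_assoc]
        rw [show hu₀.compl.vertex K ⟨E.s e, h⟩ * hu₀.compl.edge K ⟨e, h⟩ = _ from
          source_mul_edge K hu₀.compl ⟨e, h⟩])
    (fun e => LinearMap.ext fun z => by
      rw [Module.End.mul_apply, vertexOp_of_ne _ _ _ (hu₀ e)]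
      by_cases h : E.s e = u₀
      · simp only [edgeOp_of_eq _ _ _ h, ← mul_assoc, vertex_mul_self]
      · rw [edgeOp_of_ne _ _ _ h, edgeOp_of_ne _ _ _ h, ← mul_assoc]
        rw [show hu₀.compl.edge K ⟨e, h⟩ * hu₀.compl.vertex K ⟨E.r e, hu₀ e⟩ = _ from
          edge_mul_range K hu₀.compl ⟨e, h⟩])
    (fun e => LinearMap.ext fun z => by
      rw [Module.End.mul_apply, vertexOp_of_ne _ _ _ (hu₀ e)]
      by_cases h : E.s e = u₀
      · rw [ghostOp_of_eq _ _ _ h, vertex_mul_rangePart]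
      · rw [ghostOp_of_ne _ _ _ h, ← mul_assoc]
        rw [show hu₀.compl.vertex K ⟨E.r e, hu₀ e⟩ * hu₀.compl.ghost K ⟨e, h⟩ = _ from
          range_mul_ghost K hu₀.compl ⟨e, h⟩])
    (fun e => LinearMap.ext fun z => by
      rw [Module.End.mul_apply]
      by_cases h : E.s e = u₀
      · rw [ghostOp_of_eq _ _ _ h, ghostOp_of_eq _ _ _ h, h, vertexOp_self]
      · rw [ghostOp_of_ne _ _ _ h, ghostOp_of_ne _ _ _ h, vertexOp_of_ne _ _ _ h, ← mul_assoc]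
        rw [show hu₀.compl.ghost K ⟨e, h⟩ * hu₀.compl.vertex K ⟨E.s e, h⟩ = _ from
          ghost_mul_source K hu₀.compl ⟨e, h⟩])
    (fun e => LinearMap.ext fun z => by
      classical
      rw [Module.End.mul_apply, vertexOp_of_ne _ _ _ (hu₀ e)]
      by_cases h : E.s e = u₀
      · rw [edgeOp_of_eq _ _ _ h, ghostOp_of_eq _ _ _ h]
        dsimp only
        rw [Pi.single_eq_same]
      · rw [edgeOp_of_ne _ _ _ h, ghostOp_of_ne _ _ _ h, ← mul_assoc]
        rw [show hu₀.compl.ghost K ⟨e, h⟩ * hu₀.compl.edge K ⟨e, h⟩ = _ from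
          ghost_mul_edge_self K hu₀.compl ⟨e, h⟩]
        rfl)
    (fun e f hef => LinearMap.ext fun z => by
      classical
      rw [Module.End.mul_apply]
      by_cases h : E.s e = u₀
      · by_cases h' : E.s f = u₀
        · rw [edgeOp_of_eq _ _ _ h', ghostOp_of_eq _ _ _ h]
          dsimp only
          rw [Pi.single_eq_of_ne (by simpa using hef)]
          rfl
        · rw [edgeOp_of_ne _ _ _ h', ghostOp_of_eq _ _ _ h]
          rfl
      · by_cases h' : E.s f = u₀
        · rw [edgeOp_of_eq _ _ _ h', ghostOp_of_ne _ _ _ h]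
          simp
        · rw [edgeOp_of_ne _ _ _ h', ghostOp_of_ne _ _ _ h, ← mul_assoc,
            ghost_mul_edge_of_ne K hu₀.compl fun h => hef (congrArg Subtype.val h), zero_mul]
          rfl)
    (fun v hv => LinearMap.ext fun z => by
      classical
      have := Fintype.ofFinite {e : X // E.s e = v}
      rw [finsum_eq_sum_of_fintype, LinearMap.sum_apply]
      by_cases h : v = u₀
      · subst h
        rw [vertexOp_self]
        -- At the removed vertex each e e* is the projection onto its own summand, and the
        -- projections add up to the action of the vertex.
        have h' : ∀ e : {e : X // E.s e = v},
            (hu₀.edgeOp K e.1 * hu₀.ghostOp K e.1) z = (0, Pi.single e (z.2 e)) := by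
          intro e
          rw [Module.End.mul_apply, ghostOp_of_eq _ _ _ e.2, edgeOp_of_eq _ _ _ e.2]
          congr 2
          exact Subtype.ext (hu₀.vertex_mul_rangePart K _)
        simp only [h']
        refine Prod.ext ?_ ?_
        · rw [Prod.fst_sum]
          simp
        · rw [Prod.snd_sum]
          exact (Finset.univ_sum_single z.2).symm
      · rw [vertexOp_of_ne _ _ _ h]
        have hv' : ¬ hu₀.compl.IsSink ⟨v, h⟩ := fun h' => hv ((restrict_isSink_iff _).mp h')
        have h' : ∀ e : {e : X // E.s e = v},
            (hu₀.edgeOp K e.1 * hu₀.ghostOp K e.1) z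
              = (hu₀.compl.edge K ⟨e.1, fun h' => h (e.2.symm.trans h')⟩ *
                hu₀.compl.ghost K ⟨e.1, fun h' => h (e.2.symm.trans h')⟩ * z.1, 0) := by
          intro e
          have he : E.s e.1 ≠ u₀ := fun h' => h (e.2.symm.trans h')
          rw [Module.End.mul_apply, ghostOp_of_ne _ _ _ he, edgeOp_of_ne _ _ _ he, mul_assoc]
        simp only [h']
        rw [vertex_eq_finsum K _ hv',
          ← finsum_comp_equiv (restrictEdgesEquiv hu₀.isHereditary_compl ⟨v, h⟩).symm,
          finsum_eq_sum_of_fintype]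
        refine Prod.ext ?_ ?_
        · rw [Prod.fst_sum, ← Finset.sum_mul]
          rfl
        · rw [Prod.snd_sum]
          simp)

/-- On the first summand the image of y acts by left multiplication, so evaluating at z = 1 recovers
y; injectivity follows. -/
theorem spaceHom_restrictHom (y : hu₀.compl.LPA K) (z : hu₀.compl.LPA K) :
    hu₀.spaceHom K (restrictHom hu₀.isHereditary_compl K y).1 (z, 0) = (y * z, 0) := by
  induction y using LPA.induction generalizing z with
  | algebraMap r =>
    rw [(restrictHom hu₀.isHereditary_compl K).commutes r]
    -- A scalar goes to rε in the corner, and `ε` fixes (z, 0) because the vertices of E_H sum to 1.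
    change hu₀.spaceHom K (r • E.vertexSum K _) (z, 0) = _
    have := Fintype.ofFinite ({u₀}ᶜ : Set V)
    unfold vertexSum
    have h : ∀ v : ({u₀}ᶜ : Set V),
        hu₀.spaceHom K (E.vertex K v.1) (z, 0) = (hu₀.compl.vertex K v * z, 0) := by
      intro v
      unfold spaceHom
      rw [liftLPA_vertex]
      exact hu₀.vertexOp_of_ne K _ v.2
    rw [finsum_eq_sum_of_fintype, map_smul, map_sum, LinearMap.smul_apply, LinearMap.sum_apply]
    simp only [h]
    refine Prod.ext ?_ ?_
    · rw [Prod.smul_fst, Prod.fst_sum, ← Finset.sum_mul, sum_vertex, one_mul, Algebra.smul_def]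
    · rw [Prod.smul_snd, Prod.snd_sum]
      simp
  | vertex v =>
    rw [restrictHom_vertex]
    unfold spaceHom
    rw [liftLPA_vertex]
    exact hu₀.vertexOp_of_ne K _ v.2
  | edge e =>
    rw [restrictHom_edge]
    unfold spaceHom
    rw [liftLPA_edge]
    exact hu₀.edgeOp_of_ne K _ e.2
  | ghost e =>
    rw [restrictHom_ghost]
    unfold spaceHom
    rw [liftLPA_ghost]
    exact hu₀.ghostOp_of_ne K _ e.2
  | mul y y' hy hy' =>
    rw [map_mul]
    change hu₀.spaceHom K (_ * _) _ = _
    rw [map_mul, Module.End.mul_apply, hy', hy, mul_assoc]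
  | add y y' hy hy' =>
    rw [map_add]
    change hu₀.spaceHom K (_ + _) _ = _
    rw [map_add, LinearMap.add_apply, hy', hy, add_mul]
    simp

theorem injective_restrictHom : Function.Injective (restrictHom hu₀.isHereditary_compl K) := by
  intro y y' h
  have h₁ := hu₀.spaceHom_restrictHom K y 1
  rw [h, spaceHom_restrictHom, mul_one, mul_one] at h₁
  exact (congrArg Prod.fst h₁).symm

/-- The isomorphism `L_K(E_H) ≅ ε L_K(E) ε`, where `H` is the complement of the source vertex
`u₀`. -/
def restrictEquiv :
    hu₀.compl.LPA K ≃ₐ[K] (E.isIdempotentElem_vertexSum K ({u₀}ᶜ : Set V)).Corner :=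
  AlgEquiv.ofBijective (restrictHom hu₀.isHereditary_compl K)
    ⟨hu₀.injective_restrictHom K, hu₀.surjective_restrictHom K⟩

end IsSource

end DirGraph

/-! ### Paths and cycles of E_H inside E. -/

namespace DirGraph

variable {V : Type u} {X : Type w} {E : DirGraph V X} {H : Set V} (hH : E.IsHereditary H)

section Paths

theorem restrict_isWalk_iff {v : H} {l : List {e : X // E.s e ∈ H}} :
    (E.restrict H hH).IsWalk v l ↔ E.IsWalk v.1 (l.map Subtype.val) := by
  induction l generalizing v with
  | nil => exact Iff.rfl
  | cons e l ih => exact and_congr Subtype.ext_iff ih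

theorem restrict_endpoint (v : H) (l : List {e : X // E.s e ∈ H}) :
    ((E.restrict H hH).endpoint v l).1 = E.endpoint v.1 (l.map Subtype.val) := by
  induction l generalizing v with
  | nil => rfl
  | cons e l ih => exact ih _

include hH in
theorem IsHereditary.s_mem_of_isWalk {v : V} (hv : v ∈ H) {l : List X} (hl : E.IsWalk v l) :
    ∀ e ∈ l, E.s e ∈ H := by
  induction l generalizing v with
  | nil => simp
  | cons f l ih =>
    have hf : E.s f ∈ H := Set.mem_of_eq_of_mem hl.1 hv
    intro e he
    rcases List.mem_cons.mp he with rfl | he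
    · exact hf
    · exact ih (hH.r_mem hf) hl.2 e he

/-- A path of `E_H` as a path of `E`. -/
def FinPath.ofRestrict (γ : (E.restrict H hH).FinPath) : E.FinPath :=
  ⟨γ.source.1, γ.edges.map Subtype.val, (restrict_isWalk_iff hH).mp γ.isWalk⟩

theorem FinPath.ofRestrict_injective : Function.Injective (FinPath.ofRestrict hH) := by
  intro γ γ' h
  have h' := FinPath.ext_iff.mp h
  exact FinPath.ext (Subtype.ext h'.1) (List.map_injective_iff.mpr Subtype.val_injective h'.2)

/-- By heredity a path that starts in `H` never leaves it, so all its edges belong to E_H. -/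
theorem FinPath.exists_ofRestrict {γ : E.FinPath} (h : γ.source ∈ H) :
    ∃ γ', FinPath.ofRestrict hH γ' = γ := by
  obtain ⟨v, l, hl⟩ := γ
  lift l to List {e : X // E.s e ∈ H} using hH.s_mem_of_isWalk h hl
  exact ⟨⟨⟨v, h⟩, l, (restrict_isWalk_iff hH).mpr hl⟩, rfl⟩

theorem FinPath.range_ofRestrict (γ : (E.restrict H hH).FinPath) :
    (FinPath.ofRestrict hH γ).range = γ.range.1 :=
  (restrict_endpoint hH _ _).symm

theorem isCons_ofRestrict_iff {e : {e : X // E.s e ∈ H}} {γ' γ : (E.restrict H hH).FinPath} :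
    IsCons e.1 (FinPath.ofRestrict hH γ') (FinPath.ofRestrict hH γ) ↔ IsCons e γ' γ := by
  constructor
  · rintro ⟨h₁, h₂, h₃⟩
    exact ⟨Subtype.ext h₁, Subtype.ext h₂, List.map_injective_iff.mpr Subtype.val_injective h₃⟩
  · rintro ⟨h₁, h₂, h₃⟩
    exact ⟨congrArg Subtype.val h₁, congrArg Subtype.val h₂, congrArg (List.map Subtype.val) h₃⟩

theorem Cycle.exists_ofRestrict {c : E.Cycle} (hc : c.source ∈ H) :
    ∃ c' : (E.restrict H hH).Cycle, FinPath.ofRestrict hH c'.toFinPath = c.toFinPath := by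
  obtain ⟨γ, hγ⟩ := FinPath.exists_ofRestrict hH hc
  obtain ⟨hs, he⟩ := FinPath.ext_iff.mp hγ
  change γ.source.1 = _ at hs
  change γ.edges.map Subtype.val = _ at he
  refine ⟨⟨γ, Subtype.ext ?_, ?_, fun h => (restrict_isSink_iff hH).mpr ?_⟩, hγ⟩
  · rw [restrict_endpoint, hs, he, c.closed]
  · have h := c.simple
    rw [← he, List.map_map] at h
    have h' : (γ.edges.map (E.restrict H hH).s).map Subtype.val
        = γ.edges.map (E.s ∘ Subtype.val) := by
      rw [List.map_map]; rfl
    rw [← h'] at h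
    exact h.of_map _
  · rw [hs]
    exact c.sink_of_nil (by rw [← he, h]; rfl)

end Paths

/-! ### Comparison of the modules Û over E_H and over E. -/

namespace FormalPrufer

variable {hH} {c : E.Cycle} {c' : (E.restrict H hH).Cycle}
  (hc : FinPath.ofRestrict hH c'.toFinPath = c.toFinPath)

include hc

theorem isProper_ofRestrict_iff : c'.IsProper ↔ c.IsProper := by
  have h : c'.edges.map Subtype.val = c.edges := congrArg FinPath.edges hc
  unfold Cycle.IsProper
  rw [← h, ne_eq, ne_eq, List.map_eq_nil_iff]

theorem indexSet_ofRestrict : c'.indexSet = c.indexSet := by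
  unfold Cycle.indexSet
  rw [isProper_ofRestrict_iff hc]

theorem mem_paths_ofRestrict_iff {γ : (E.restrict H hH).FinPath} :
    FinPath.ofRestrict hH γ ∈ c.paths ↔ γ ∈ c'.paths := by
  have h : c'.edges.map Subtype.val = c.edges := congrArg FinPath.edges hc
  have h' : c'.source.1 = c.source := congrArg FinPath.source hc
  refine and_congr ?_ (imp_congr (isProper_ofRestrict_iff hc).symm (not_congr ?_))
  · rw [FinPath.range_ofRestrict, ← h', Subtype.ext_iff]
  · rw [← h]
    exact List.suffix_map_iff_of_injective Subtype.val_injective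

/-- The inclusion `𝒫_c(E_H) → 𝒫_c(E)`. -/
def pathsIncl (γ : c'.paths) : c.paths :=
  ⟨FinPath.ofRestrict hH γ.1, (mem_paths_ofRestrict_iff hc).mpr γ.2⟩

theorem pathsIncl_injective : Function.Injective (pathsIncl hc) := fun _ _ h =>
  Subtype.ext (FinPath.ofRestrict_injective hH (congrArg Subtype.val h))

theorem exists_pathsIncl {μ : c.paths} (h : μ.1.source ∈ H) : ∃ γ, pathsIncl hc γ = μ := by
  obtain ⟨γ, hγ⟩ := FinPath.exists_ofRestrict hH h
  exact ⟨⟨γ, (mem_paths_ofRestrict_iff hc).mp (hγ ▸ μ.2)⟩, Subtype.ext hγ⟩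

theorem pathsIncl_basePath : pathsIncl hc c'.basePath = c.basePath := by
  have h : c'.source.1 = c.source := congrArg FinPath.source hc
  exact Subtype.ext (FinPath.ext h rfl)

theorem isCons_cycle_iff {e : {e : X // E.s e ∈ H}} {ν : c'.paths} :
    IsCons e.1 (pathsIncl hc ν).1 c.toFinPath ↔ IsCons e ν.1 c'.toFinPath := by
  rw [← hc]
  exact isCons_ofRestrict_iff hH

theorem exists_isCons_cycle {e : {e : X // E.s e ∈ H}}
    (h : ∃ ν : c.paths, IsCons e.1 ν.1 c.toFinPath) :
    ∃ ν : c'.paths, IsCons e ν.1 c'.toFinPath := by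
  obtain ⟨ν, h⟩ := h
  obtain ⟨ν, rfl⟩ := exists_pathsIncl hc
    (Set.mem_of_eq_of_mem h.range_eq.symm (hH.r_mem e.2))
  exact ⟨ν, (isCons_cycle_iff hc).mp h⟩

/-- A path of 𝒫_c comes from E_H or starts outside `H`; the comparisons of series below follow this
dichotomy. -/
theorem series_ext {Y : Type*} {p q : c.paths → Y} (h : ∀ γ, p (pathsIncl hc γ) = q (pathsIncl hc γ))
    (h' : ∀ μ : c.paths, μ.1.source ∉ H → p μ = q μ) : p = q := by
  funext μ
  by_cases hμ : μ.1.source ∈ H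
  · obtain ⟨γ, rfl⟩ := exists_pathsIncl hc hμ
    exact h γ
  · exact h' μ hμ

variable (K : Type k) [Field K]

/-- Extension by zero `K[[𝒫_c(E_H)]] → K[[𝒫_c(E)]]`. -/
def seriesIncl : (c'.paths → K) →ₗ[K] (c.paths → K) :=
  Function.ExtendByZero.linearMap K (pathsIncl hc)

/-- Restriction `K[[𝒫_c(E)]] → K[[𝒫_c(E_H)]]`. -/
def seriesRestrict : (c.paths → K) →ₗ[K] (c'.paths → K) :=
  LinearMap.funLeft K K (pathsIncl hc)

variable {K}

theorem seriesIncl_apply (p : c'.paths → K) (γ : c'.paths) :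
    seriesIncl hc K p (pathsIncl hc γ) = p γ :=
  (pathsIncl_injective hc).extend_apply _ _ _

theorem seriesIncl_apply_of_notMem (p : c'.paths → K) {μ : c.paths} (h : μ.1.source ∉ H) :
    seriesIncl hc K p μ = 0 :=
  Function.extend_apply' _ _ _ (by rintro ⟨γ, rfl⟩; exact h γ.1.source.2)

theorem seriesRestrict_seriesIncl (p : c'.paths → K) :
    seriesRestrict hc K (seriesIncl hc K p) = p :=
  funext fun γ => seriesIncl_apply hc p γ

/-- Both sides keep the coefficients at paths starting in `H` and discard the others. This is the
action of `ε` on series. -/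
theorem seriesIncl_seriesRestrict [Fintype H] (p : c.paths → K) :
    seriesIncl hc K (seriesRestrict hc K p) = ∑ v : H, vertexPart K c v.1 p := by
  classical
  refine series_ext hc (fun γ => ?_) fun μ h => ?_
  · rw [seriesIncl_apply, Finset.sum_apply, Finset.sum_eq_single γ.1.source]
    · exact (vertexPart_apply_eq rfl p).symm
    · intro v _ hne
      exact vertexPart_apply_ne (fun h => hne (Subtype.ext h.symm)) p
    · simp
  · rw [seriesIncl_apply_of_notMem hc _ h, Finset.sum_apply, Finset.sum_eq_zero]
    intro v _
    exact vertexPart_apply_ne (fun h' => h (h' ▸ v.2)) p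

open scoped Classical in
theorem seriesIncl_single (γ : c'.paths) (y : K) :
    seriesIncl hc K (Pi.single γ y) = Pi.single (pathsIncl hc γ) y := by
  refine series_ext hc (fun γ' => ?_) fun μ h => ?_
  · rw [seriesIncl_apply]
    simp only [Pi.single_apply, (pathsIncl_injective hc).eq_iff]
  · rw [seriesIncl_apply_of_notMem hc _ h, Pi.single_eq_of_ne]
    rintro rfl
    exact h γ.1.source.2

theorem vertexPart_seriesIncl (v : H) (p : c'.paths → K) :
    vertexPart K c v.1 (seriesIncl hc K p) = seriesIncl hc K (vertexPart K c' v p) := by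
  refine series_ext hc (fun γ => ?_) fun μ h => ?_
  · rw [seriesIncl_apply]
    by_cases hv : γ.1.source = v
    · rw [vertexPart_apply_eq hv, vertexPart_apply_eq (congrArg Subtype.val hv), seriesIncl_apply]
    · rw [vertexPart_apply_ne hv, vertexPart_apply_ne fun h => hv (Subtype.ext h)]
  · rw [seriesIncl_apply_of_notMem hc _ h, vertexPart_apply_ne fun h' => h (h' ▸ v.2)]

/-- Both ends of e lie in `H`, so adding or removing e at the front relates only paths starting in
`H`. The same reason serves for the ghost, wrap and unwrap parts. -/
theorem edgePart_seriesIncl (e : {e : X // E.s e ∈ H}) (p : c'.paths → K) :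
    edgePart K c e.1 (seriesIncl hc K p) = seriesIncl hc K (edgePart K c' e p) := by
  refine series_ext hc (fun γ => ?_) fun μ h => ?_
  · rw [seriesIncl_apply]
    by_cases hγ : ∃ γ' : c'.paths, IsCons e γ'.1 γ.1
    · obtain ⟨γ', hγ⟩ := hγ
      have hγ' : IsCons e.1 (pathsIncl hc γ').1 (pathsIncl hc γ).1 :=
        (isCons_ofRestrict_iff hH).mpr hγ
      rw [edgePart_of hγ, edgePart_of hγ', seriesIncl_apply]
    · rw [edgePart_not hγ, edgePart_not]
      rintro ⟨μ', h⟩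
      obtain ⟨γ', rfl⟩ := exists_pathsIncl hc (Set.mem_of_eq_of_mem h.range_eq.symm (hH.r_mem e.2))
      exact hγ ⟨γ', (isCons_ofRestrict_iff hH).mp h⟩
  · rw [seriesIncl_apply_of_notMem hc _ h, edgePart_not]
    rintro ⟨μ', h'⟩
    exact h (Set.mem_of_eq_of_mem h'.source_eq e.2)

theorem ghostPart_seriesIncl (e : {e : X // E.s e ∈ H}) (p : c'.paths → K) :
    ghostPart K c e.1 (seriesIncl hc K p) = seriesIncl hc K (ghostPart K c' e p) := by
  refine series_ext hc (fun γ' => ?_) fun μ' h => ?_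
  · rw [seriesIncl_apply]
    by_cases hγ : ∃ γ : c'.paths, IsCons e γ'.1 γ.1
    · obtain ⟨γ, hγ⟩ := hγ
      have hγ' : IsCons e.1 (pathsIncl hc γ').1 (pathsIncl hc γ).1 :=
        (isCons_ofRestrict_iff hH).mpr hγ
      rw [ghostPart_of hγ, ghostPart_of hγ', seriesIncl_apply]
    · rw [ghostPart_not hγ, ghostPart_not]
      rintro ⟨μ, h⟩
      obtain ⟨γ, rfl⟩ := exists_pathsIncl hc (Set.mem_of_eq_of_mem h.source_eq e.2)
      exact hγ ⟨γ, (isCons_ofRestrict_iff hH).mp h⟩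
  · rw [seriesIncl_apply_of_notMem hc _ h, ghostPart_not]
    rintro ⟨μ, h'⟩
    exact h (Set.mem_of_eq_of_mem h'.range_eq.symm (hH.r_mem e.2))

theorem wrapPart_seriesIncl (e : {e : X // E.s e ∈ H}) (p : c'.paths → K) :
    wrapPart K c e.1 (seriesIncl hc K p) = seriesIncl hc K (wrapPart K c' e p) := by
  classical
  by_cases h : ∃ ν : c'.paths, IsCons e ν.1 c'.toFinPath
  · obtain ⟨ν, h⟩ := h
    rw [wrapPart_of h, wrapPart_of ((isCons_cycle_iff hc).mpr h), seriesIncl_single,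
      seriesIncl_apply, pathsIncl_basePath]
  · rw [wrapPart_not h, wrapPart_not fun h' => h (exists_isCons_cycle hc h')]
    simp

theorem unwrapPart_seriesIncl (e : {e : X // E.s e ∈ H}) (p : c'.paths → K) :
    unwrapPart K c e.1 (seriesIncl hc K p) = seriesIncl hc K (unwrapPart K c' e p) := by
  classical
  by_cases h : ∃ ν : c'.paths, IsCons e ν.1 c'.toFinPath
  · obtain ⟨ν, h⟩ := h
    rw [unwrapPart_of h, unwrapPart_of ((isCons_cycle_iff hc).mpr h), seriesIncl_single,
      ← pathsIncl_basePath hc, seriesIncl_apply]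
  · rw [unwrapPart_not h, unwrapPart_not fun h' => h (exists_isCons_cycle hc h')]
    simp

variable (K) in
/-- The inclusion of the formal Prüfer module over `E_H` into the one over `E`. -/
def pruferIncl : FormalPrufer K c' →ₗ[K] FormalPrufer K c :=
  Finsupp.lsum K fun j : c'.indexSet => alpha K c j.1 ∘ₗ seriesIncl hc K

variable (K) in
/-- The projection of the formal Prüfer module over `E` onto the one over `E_H`. -/
def pruferRestrict : FormalPrufer K c →ₗ[K] FormalPrufer K c' :=
  Finsupp.lsum K fun j : c.indexSet => alpha K c' j.1 ∘ₗ seriesRestrict hc K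

theorem pruferIncl_alpha (j : ℕ) (p : c'.paths → K) :
    pruferIncl hc K (alpha K c' j p) = alpha K c j (seriesIncl hc K p) := by
  by_cases h : j ∈ c'.indexSet
  · rw [alpha_of_mem h]
    exact Finsupp.lsum_single K (fun j : c'.indexSet => alpha K c j.1 ∘ₗ seriesIncl hc K) ⟨j, h⟩ p
  -- Indices outside the common index set, in particular 0, give zero on both sides; the actions do
  -- produce such terms through j - 1.
  · rw [alpha_of_not_mem h, alpha_of_not_mem (indexSet_ofRestrict hc ▸ h)]
    simp

theorem pruferRestrict_alpha (j : ℕ) (p : c.paths → K) :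
    pruferRestrict hc K (alpha K c j p) = alpha K c' j (seriesRestrict hc K p) := by
  by_cases h : j ∈ c.indexSet
  · rw [alpha_of_mem h]
    exact Finsupp.lsum_single K (fun j : c.indexSet => alpha K c' j.1 ∘ₗ seriesRestrict hc K)
      ⟨j, h⟩ p
  · rw [alpha_of_not_mem h, alpha_of_not_mem (indexSet_ofRestrict hc ▸ h)]
    simp

theorem pruferIncl_altAlpha (j : ℕ) (p : c'.paths → K) :
    pruferIncl hc K (altAlpha K c' j p) = altAlpha K c j (seriesIncl hc K p) := by
  simp only [altAlpha, LinearMap.sum_apply, LinearMap.smul_apply, map_sum, map_smul,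
    pruferIncl_alpha]

omit hc in
theorem hom_ext {P : Type*} [AddCommGroup P] [Module K P] {f g : FormalPrufer K c →ₗ[K] P}
    (h : ∀ j p, f (alpha K c j p) = g (alpha K c j p)) : f = g := by
  refine Finsupp.lhom_ext' fun j => LinearMap.ext fun p => ?_
  have h' := h j.1 p
  rw [alpha_of_mem j.2] at h'
  exact h'

theorem vertexAct_pruferIncl (v : H) (n : FormalPrufer K c') :
    vertexAct K c v.1 (pruferIncl hc K n) = pruferIncl hc K (vertexAct K c' v n) := by
  refine LinearMap.congr_fun (f := vertexAct K c v.1 ∘ₗ pruferIncl hc K)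
    (g := pruferIncl hc K ∘ₗ vertexAct K c' v) (hom_ext fun j p => ?_) n
  simp only [LinearMap.comp_apply, vertexAct_alpha, pruferIncl_alpha, vertexPart_seriesIncl]

theorem edgeAct_pruferIncl (e : {e : X // E.s e ∈ H}) (n : FormalPrufer K c') :
    edgeAct K c e.1 (pruferIncl hc K n) = pruferIncl hc K (edgeAct K c' e n) := by
  refine LinearMap.congr_fun (f := edgeAct K c e.1 ∘ₗ pruferIncl hc K)
    (g := pruferIncl hc K ∘ₗ edgeAct K c' e) (hom_ext fun j p => ?_) n
  simp only [LinearMap.comp_apply, edgeAct_alpha, pruferIncl_alpha, edgePart_seriesIncl,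
    wrapPart_seriesIncl, map_add]

theorem ghostAct_pruferIncl (e : {e : X // E.s e ∈ H}) (n : FormalPrufer K c') :
    ghostAct K c e.1 (pruferIncl hc K n) = pruferIncl hc K (ghostAct K c' e n) := by
  refine LinearMap.congr_fun (f := ghostAct K c e.1 ∘ₗ pruferIncl hc K)
    (g := pruferIncl hc K ∘ₗ ghostAct K c' e) (hom_ext fun j p => ?_) n
  simp only [LinearMap.comp_apply, ghostAct_alpha, pruferIncl_alpha, pruferIncl_altAlpha,
    ghostPart_seriesIncl, unwrapPart_seriesIncl, map_add]

theorem pruferRestrict_pruferIncl (n : FormalPrufer K c') :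
    pruferRestrict hc K (pruferIncl hc K n) = n := by
  refine LinearMap.congr_fun (f := pruferRestrict hc K ∘ₗ pruferIncl hc K)
    (g := LinearMap.id) (hom_ext fun j p => ?_) n
  simp only [LinearMap.comp_apply, pruferIncl_alpha, pruferRestrict_alpha,
    seriesRestrict_seriesIncl, LinearMap.id_apply]

theorem pruferIncl_pruferRestrict [Fintype H] (m : FormalPrufer K c) :
    pruferIncl hc K (pruferRestrict hc K m) = ∑ v : H, vertexAct K c v.1 m := by
  rw [← LinearMap.sum_apply]
  refine LinearMap.congr_fun (f := pruferIncl hc K ∘ₗ pruferRestrict hc K)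
    (hom_ext fun j p => ?_) m
  simp only [LinearMap.comp_apply, pruferIncl_alpha, pruferRestrict_alpha,
    seriesIncl_seriesRestrict, LinearMap.sum_apply, vertexAct_alpha, map_sum]

section Action

omit hc

variable [Finite V] [Finite X]

theorem smul_def' (y : E.LPA K) (m : FormalPrufer K c) : y • m = actHom K c y m := rfl

theorem vertex_smul (v : V) (m : FormalPrufer K c) : E.vertex K v • m = vertexAct K c v m := by
  rw [smul_def', actHom, liftLPA_vertex]

theorem edge_smul (e : X) (m : FormalPrufer K c) : E.edge K e • m = edgeAct K c e m := by
  rw [smul_def', actHom, liftLPA_edge]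

theorem ghost_smul (e : X) (m : FormalPrufer K c) : E.ghost K e • m = ghostAct K c e m := by
  rw [smul_def', actHom, liftLPA_ghost]

instance : IsScalarTower K (E.LPA K) (FormalPrufer K c) where
  smul_assoc r y m := by rw [smul_def', map_smul]; rfl

include hc

theorem vertexSum_smul (m : FormalPrufer K c) :
    E.vertexSum K H • m = pruferIncl hc K (pruferRestrict hc K m) := by
  have := Fintype.ofFinite H
  rw [vertexSum, finsum_eq_sum_of_fintype, Finset.sum_smul, pruferIncl_pruferRestrict]
  simp only [vertex_smul]

theorem vertexSum_smul_pruferIncl (n : FormalPrufer K c') :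
    E.vertexSum K H • pruferIncl hc K n = pruferIncl hc K n := by
  rw [vertexSum_smul hc, pruferRestrict_pruferIncl]

/-- Extension after restriction is the action of `ε`, so the image of the inclusion is ε Û. -/
theorem mem_range_pruferIncl_iff (m : FormalPrufer K c) :
    m ∈ Set.range (pruferIncl hc K) ↔ E.vertexSum K H • m = m := by
  constructor
  · rintro ⟨n, rfl⟩
    exact vertexSum_smul_pruferIncl hc n
  · intro h
    exact ⟨pruferRestrict hc K m, by rw [← vertexSum_smul hc, h]⟩

/-- It suffices to compare generators, which are matched above, and scalars: r goes to rε, and `ε`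
fixes the image of the inclusion. -/
theorem pruferIncl_smul (y : (E.restrict H hH).LPA K) (n : FormalPrufer K c') :
    pruferIncl hc K (y • n) = (restrictHom hH K y).1 • pruferIncl hc K n := by
  induction y using LPA.induction generalizing n with
  | algebraMap r =>
    rw [(restrictHom hH K).commutes r, algebraMap_smul, map_smul]
    change _ = (r • E.vertexSum K H) • _
    rw [smul_assoc, vertexSum_smul_pruferIncl]
  | vertex v => rw [restrictHom_vertex, vertex_smul, vertex_smul, vertexAct_pruferIncl]
  | edge e => rw [restrictHom_edge, edge_smul, edge_smul, edgeAct_pruferIncl]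
  | ghost e => rw [restrictHom_ghost, ghost_smul, ghost_smul, ghostAct_pruferIncl]
  | mul y y' hy hy' =>
    rw [map_mul, mul_smul, hy, hy', ← mul_smul]
    rfl
  | add y y' hy hy' =>
    rw [map_add, add_smul, map_add, hy, hy', ← add_smul]
    rfl

end Action

end FormalPrufer

/-- A cycle does not pass through a source vertex which is not isolated. -/
theorem IsSource.source_cycle_ne {u₀ : V} (hu₀ : E.IsSource u₀) (hns : ¬ E.IsSink u₀)
    (c : E.Cycle) : c.source ≠ u₀ := by
  obtain ⟨⟨v, l, hl⟩, hclosed, _, hsink⟩ := c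
  cases l with
  | nil =>
    rintro rfl
    exact hns (hsink rfl)
  | cons e l =>
    -- After its first edge the path is in the complement of `u₀`, which is hereditary, so the
    -- vertex at which it closes up is not `u₀`.
    have h : E.endpoint (E.r e) l ∈ ({u₀}ᶜ : Set V) :=
      hu₀.isHereditary_compl ⟨E.r e, l, hl.2⟩ (hu₀ e)
    exact Set.mem_of_eq_of_mem hclosed.symm h

end DirGraph

end

/-! ### The theorem. -/

open CategoryTheory in
theorem lemma5p5 {K : Type k} [Field K] {V : Type u} {X : Type w} [Finite V] [Finite X]
    (E : DirGraph V X) (hE : E.HasDisjointCycles) (u₀ : V) (hu₀ : E.IsSource u₀)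
    (hns : ¬ E.IsSink u₀) :
    let H : Set V := {u₀}ᶜ
    let F : DirGraph H {e : X // E.s e ∈ H} := E.restrict H hu₀.isHereditary_compl
    let ε : E.LPA K := E.vertexSum K H
    let hε : IsIdempotentElem ε := E.isIdempotentElem_vertexSum K H
    ∃ φ : F.LPA K ≃ₐ[K] hε.Corner,
      (∀ v, (φ (F.vertex K v)).1 = E.vertex K v.1) ∧
      (∀ e, (φ (F.edge K e)).1 = E.edge K e.1) ∧
      (∀ e, (φ (F.ghost K e)).1 = E.ghost K e.1) ∧
      ∃ m : MoritaEquivalence K (E.LPA K) (F.LPA K),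
        Nonempty (m.eqv.functor ≅
          bimoduleTensorFunctor hε.Corner (E.LPA K) hε.rightIdeal ⋙
            ModuleCat.restrictScalars φ.toRingEquiv.toRingHom) ∧
        Nonempty (m.eqv.inverse ≅
          ModuleCat.restrictScalars φ.symm.toRingEquiv.toRingHom ⋙
            bimoduleTensorFunctor (E.LPA K) hε.Corner hε.leftIdeal) ∧
        ∀ c : E.Cycle, ∃ c' : F.Cycle,
          c'.source.1 = c.source ∧ c'.edges.map Subtype.val = c.edges ∧
          Nonempty (ModuleCat.of (E.LPA K) (DirGraph.FormalPrufer K c) ≅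
            (bimoduleTensorFunctor (E.LPA K) hε.Corner hε.leftIdeal).obj
              ((ModuleCat.restrictScalars φ.symm.toRingEquiv.toRingHom).obj
                (ModuleCat.of (F.LPA K) (DirGraph.FormalPrufer K c')))) := by

  intro H F ε hε
  have hfull : hε.IsFull := hu₀.isFull_vertexSum K hns
  let φ : F.LPA K ≃ₐ[K] hε.Corner := hu₀.restrictEquiv K
  -- The equivalence was built from the two tensor functors and restriction of scalars along `φ`, so
  -- both required isomorphisms of functors are identities.
  refine ⟨φ, DirGraph.restrictHom_vertex _ K, DirGraph.restrictHom_edge _ K,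
    DirGraph.restrictHom_ghost _ K, hfull.moritaEquivalence K φ, ⟨Iso.refl _⟩, ⟨Iso.refl _⟩,
    fun c => ?_⟩
  obtain ⟨c', hc⟩ := DirGraph.Cycle.exists_ofRestrict hu₀.isHereditary_compl
    (hu₀.source_cycle_ne hns c)
  refine ⟨c', congrArg DirGraph.FinPath.source hc, congrArg DirGraph.FinPath.edges hc, ⟨?_⟩⟩
  -- Here `N` is Û over E_H, made a module over the corner through the inverse of `φ`, and g is
  -- extension by zero, with image ε Û.
  refine (LinearEquiv.toModuleIso (hfull.leftTensorEquiv
    (N := (ModuleCat.restrictScalars φ.symm.toRingEquiv.toRingHom).obj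
      (ModuleCat.of (F.LPA K) (DirGraph.FormalPrufer K c')))
    (DirGraph.FormalPrufer.pruferIncl hc K).toAddMonoidHom (fun r n => ?_) ?_ ?_)).symm
  -- An element r of the corner acts on n as φ⁻¹(r), which the inclusion turns back into φ(φ⁻¹(r)) =
  -- r.
  · refine (DirGraph.FormalPrufer.pruferIncl_smul hc (φ.symm r) n).trans ?_
    exact congrArg (fun y : hε.Corner => y.1 • DirGraph.FormalPrufer.pruferIncl hc K n)
      (φ.apply_symm_apply r)
  · exact Function.LeftInverse.injective (DirGraph.FormalPrufer.pruferRestrict_pruferIncl hc)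
  · exact DirGraph.FormalPrufer.mem_range_pruferIncl_iff hc
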